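/- Let $k$ be a field and let $Q$ be a finite quiver, with vertex set $Q_0$, arrow set $Q_1$, set $Q_\ell$ of paths of length $\ell$, and source and target maps $s,t$. Paths are read from left to right, $e_i$ is the trivial path at $i$, and the path algebra $kQ$ is graded by path length, with $kQ_0=\bigoplus_i k e_i$ its degree $0$ component. **Weak bialgebras.** A weak bialgebra is a $k$-algebra and $k$-coalgebra $(H,m,1,\Delta,\varepsilon)$ with $\Delta(ab)=\Delta(a)\Delta(b)$, $\varepsilon(abc)=\varepsilon(ab_1)\varepsilon(b_2c)=\varepsilon(ab_2)\varepsilon(b_1c)$ and $\Delta^2(1)=(\Delta(1)\otimes 1)(1\otimes\Delta(1))=(1\otimes\Delta(1))(\Delta(1)\otimes 1)$. Its counital subalgebras $H_s,H_t$ are the images of $\varepsilon_s(x)=1_1\,\varepsilon(x1_2)$ and $\varepsilon_t(x)=\varepsilon(1_1x)\,1_2$. Weak bialgebra maps are maps of algebras and coalgebras. **Coactions.** A left (right) coaction of $H$ on $kQ$ here is a left (right) comodule structure $\lambda:kQ\to H\otimes kQ$ (resp. $\rho:kQ\to kQ\otimes H$) that is multiplicative, satisfies $\lambda(1)\in H_s\otimes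 kQ$ (resp. $\rho(1)\in kQ\otimes H_t$), and restricts to a coaction on each graded component. It is *base preserving* if there is an isomorphism of algebras and of $H$-comodules $kQ_0\cong H_t$ (resp. $kQ_0\cong H_s$), where $H_t$ (resp. $H_s$) is a comodule via $\Delta$. Coactions $\lambda,\rho$ of the same $H$ are *transposed* (with respect to the path basis of $kQ$) if for every $\ell$ there are $z_{a,b}\in H$ $(a,b\in Q_\ell)$ with $\lambda(a)=\sum_{b\in Q_\ell}z_{a,b}\otimes b$ and $\rho(a)=\sum_{b\in Q_\ell}b\otimes z_{b,a}$ for all $a\in Q_\ell$. **Universal quantum linear semigroupoids (UQSGds).** A left UQSGd of $kQ$ is a weak bialgebra $\mathcal O$ with a base preserving left coaction $\lambda^{\mathcal O}$ on $kQ$ such that for every weak bialgebra $H$ with a base preserving left coaction $\lambda^H$ on $kQ$ there is a unique weak bialgebra map $\pi:\mathcal O\to H$ with $(\pi\otimes\mathrm{id})\lambda^{\mathcal O}=\lambda^H$. A right UQSGd is defined in the same way with base preserving right coactions and $(\mathrm{id}\otimes\pi)\rho^{\mathcal O}=\rho^H$. A transposed UQSGd is a weak bialgebra $\mathcal O$ with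 a transposed pair $(\lambda^{\mathcal O},\rho^{\mathcal O})$ of base preserving coactions such that for every weak bialgebra $H$ with a transposed pair $(\lambda^H,\rho^H)$ of base preserving coactions there is a unique weak bialgebra map $\pi:\mathcal O\to H$ with $(\pi\otimes\mathrm{id})\lambda^{\mathcal O}=\lambda^H$ and $(\mathrm{id}\otimes\pi)\rho^{\mathcal O}=\rho^H$. **Hayashi's face algebra.** $\mathfrak H(Q)$ is the $k$-algebra generated by $x_{i,j}$ $(i,j\in Q_0)$ and $x_{p,q}$ $(p,q\in Q_1)$ with relations $\sum_{i,j}x_{i,j}=1$, $x_{i,j}x_{i',j'}=\delta_{i,i'}\delta_{j,j'}x_{i,j}$ and $x_{s(p),s(q)}x_{p,q}=x_{p,q}=x_{p,q}x_{t(p),t(q)}$. Write $x_{e_i,e_j}=x_{i,j}$ and $x_{p_1\cdots p_\ell,\,q_1\cdots q_\ell}=x_{p_1,q_1}\cdots x_{p_\ell,q_\ell}$ for paths $p_1\cdots p_\ell$ and $q_1\cdots q_\ell$; these elements form a basis. The weak bialgebra structure is $\Delta(x_{a,b})=\sum_{c\in Q_\ell}x_{a,c}\otimes x_{c,b}$,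 $\varepsilon(x_{a,b})=\delta_{a,b}$ for $a,b\in Q_\ell$. Its standard coactions on $kQ$ are $\lambda(a)=\sum_{b\in Q_\ell}x_{a,b}\otimes b$ and $\rho(a)=\sum_{b\in Q_\ell}b\otimes x_{b,a}$ for $a\in Q_\ell$. **Theorem 1.1 (= Theorem 4.5).** The left, right and transposed UQSGds of $kQ$ exist: $\mathfrak H(Q)$ with $\lambda$, with $\rho$, and with $(\lambda,\rho)$, is respectively a left, a right and a transposed UQSGd of $kQ$. Moreover, each left, right or transposed UQSGd of $kQ$ is isomorphic to $\mathfrak H(Q)$ as a weak bialgebra, by an isomorphism that carries its coaction(s) to the standard one(s). -/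

import Mathlib

namespace UQSGd

open scoped TensorProduct

/-! ### Weak bialgebras -/

/-- A weak bialgebra over `k`: an algebra and coalgebra `H` such that
* `Δ(ab) = Δ(a)Δ(b)`,
* `ε(abc) = ε(ab₁)ε(b₂c) = ε(ab₂)ε(b₁c)`,
* `Δ²(1) = (Δ(1) ⊗ 1)(1 ⊗ Δ(1)) = (1 ⊗ Δ(1))(Δ(1) ⊗ 1)`. -/
class WeakBialgebra (k H : Type*) [Field k] [Ring H] extends Algebra k H, Coalgebra k H where
  comul_mul : ∀ a b : H, comul (a * b) = comul a * comul b
  counit_mul_mul : ∀ a b c : H, counit (a * b * c) = LinearMap.mul' k k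
    (TensorProduct.map (counit ∘ₗ LinearMap.mulLeft k a) (counit ∘ₗ LinearMap.mulRight k c)
      (comul b))
  counit_mul_mul_swap : ∀ a b c : H, counit (a * b * c) = LinearMap.mul' k k
    (TensorProduct.map (counit ∘ₗ LinearMap.mulLeft k a) (counit ∘ₗ LinearMap.mulRight k c)
      (TensorProduct.comm k H H (comul b)))
  comul_one : comul.lTensor H (comul (1 : H)) =
    TensorProduct.assoc k H H H (comul (1 : H) ⊗ₜ[k] 1) * ((1 : H) ⊗ₜ[k] comul (1 : H))
  comul_one_swap : comul.lTensor H (comul (1 : H)) =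
    ((1 : H) ⊗ₜ[k] comul (1 : H)) * TensorProduct.assoc k H H H (comul (1 : H) ⊗ₜ[k] 1)

/-! ### Algebras spanned by a partial composition -/

/-- A set `P` with a partially defined associative composition and finitely many local
identities (that is, the set of morphisms of a small category with finitely many objects). -/
class PartialComp (P : Type*) where
  /-- The composite, if it is defined. -/
  comp : P → P → Option P
  /-- The local identities. -/
  ids : Finset P
  /-- The left identity of an element. -/
  lid : P → P
  /-- The right identity of an element. -/
  rid : P → P
  assoc : ∀ a b c, (comp a b).bind (fun d => comp d c) = (comp b c).bind (fun d => comp a d)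
  lid_mem : ∀ a, lid a ∈ ids
  rid_mem : ∀ a, rid a ∈ ids
  lid_comp : ∀ a, comp (lid a) a = some a
  comp_rid : ∀ a, comp a (rid a) = some a
  eq_lid : ∀ i ∈ ids, ∀ a, comp i a ≠ none → i = lid a
  eq_rid : ∀ i ∈ ids, ∀ a, comp a i ≠ none → i = rid a

/-- The `k`-vector space with basis `P`. -/
def CompAlgebra (k P : Type*) [Field k] : Type _ := P →₀ k

namespace CompAlgebra

variable (k : Type*) [Field k] {P : Type*}

noncomputable instance : AddCommGroup (CompAlgebra k P) := inferInstanceAs (AddCommGroup (P →₀ k))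

noncomputable instance : Module k (CompAlgebra k P) := inferInstanceAs (Module k (P →₀ k))

variable (P) in
/-- The standard basis of `CompAlgebra k P`. -/
noncomputable def basis : Module.Basis P k (CompAlgebra k P) := .ofRepr (LinearEquiv.refl k (P →₀ k))

/-- The basis vector of `p`, or zero if the composite is undefined. -/
noncomputable def ofOption : Option P → CompAlgebra k P
  | none => 0
  | some p => basis k P p

@[simp] lemma ofOption_none : ofOption k (none : Option P) = 0 := rfl

@[simp] lemma ofOption_some (p : P) : ofOption k (some p) = basis k P p := rfl

lemma induction_on {p : CompAlgebra k P → Prop} (x : CompAlgebra k P)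
    (basis : ∀ a, p (basis k P a)) (zero : p 0) (add : ∀ x y, p x → p y → p (x + y))
    (smul : ∀ (c : k) x, p x → p (c • x)) : p x := by
  have hx : x ∈ Submodule.span k (Set.range (CompAlgebra.basis k P)) := by
    rw [Module.Basis.span_eq]; trivial
  induction hx using Submodule.span_induction with
  | mem y hy => obtain ⟨a, rfl⟩ := hy; exact basis a
  | zero => exact zero
  | add y z _ _ hy hz => exact add y z hy hz
  | smul c y _ hy => exact smul c y hy

variable [PartialComp P]

/-- The product is the bilinear extension of composition, where an undefined composite is zero. -/
noncomputable def mulMap : CompAlgebra k P →ₗ[k] CompAlgebra k P →ₗ[k] CompAlgebra k P :=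
  (basis k P).constr k fun a => (basis k P).constr k fun b => ofOption k (PartialComp.comp a b)

noncomputable instance : Mul (CompAlgebra k P) := ⟨fun x y => mulMap k x y⟩

noncomputable instance : One (CompAlgebra k P) :=
  ⟨∑ i ∈ (PartialComp.ids : Finset P), basis k P i⟩

lemma mul_def (x y : CompAlgebra k P) : x * y = mulMap k x y := rfl

lemma one_def : (1 : CompAlgebra k P) = ∑ i ∈ (PartialComp.ids : Finset P), basis k P i := rfl

@[simp] lemma basis_mul_basis (a b : P) :
    basis k P a * basis k P b = ofOption k (PartialComp.comp a b) := by
  simp [mul_def, mulMap, Module.Basis.constr_basis]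

lemma mul_add' (x y z : CompAlgebra k P) : x * (y + z) = x * y + x * z := by
  simp [mul_def]

lemma add_mul' (x y z : CompAlgebra k P) : (x + y) * z = x * z + y * z := by
  simp [mul_def]

lemma smul_mul' (c : k) (x y : CompAlgebra k P) : (c • x) * y = c • (x * y) := by
  simp [mul_def]

lemma mul_smul' (c : k) (x y : CompAlgebra k P) : x * (c • y) = c • (x * y) := by
  simp [mul_def]

lemma mul_zero' (x : CompAlgebra k P) : x * 0 = 0 := by
  simp [mul_def]

lemma zero_mul' (x : CompAlgebra k P) : 0 * x = 0 := by
  simp [mul_def]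

lemma ofOption_mul_basis (o : Option P) (c : P) :
    ofOption k o * basis k P c = ofOption k (o.bind fun d => PartialComp.comp d c) := by
  cases o <;> simp [zero_mul']

lemma basis_mul_ofOption (o : Option P) (c : P) :
    basis k P c * ofOption k o = ofOption k (o.bind fun d => PartialComp.comp c d) := by
  cases o <;> simp [mul_zero']

lemma mul_assoc' (x y z : CompAlgebra k P) : x * y * z = x * (y * z) := by
  induction x using induction_on with
  | zero => simp [zero_mul']
  | add x₁ x₂ h₁ h₂ => simp [add_mul', h₁, h₂]
  | smul c x h => simp [smul_mul', h]
  | basis a =>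
  induction y using induction_on with
  | zero => simp [zero_mul', mul_zero']
  | add x₁ x₂ h₁ h₂ => simp [add_mul', mul_add', h₁, h₂]
  | smul c x h => simp [smul_mul', mul_smul', h]
  | basis b =>
  induction z using induction_on with
  | zero => simp [mul_zero']
  | add x₁ x₂ h₁ h₂ => rw [mul_add', mul_add', mul_add', h₁, h₂]
  | smul c x h => rw [mul_smul', mul_smul', mul_smul', h]
  | basis c =>
  rw [basis_mul_basis, basis_mul_basis, ofOption_mul_basis, basis_mul_ofOption, PartialComp.assoc]

lemma one_mul' (x : CompAlgebra k P) : 1 * x = x := by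
  induction x using induction_on with
  | zero => simp [mul_zero']
  | add x₁ x₂ h₁ h₂ => simp [mul_add', h₁, h₂]
  | smul c x h => simp [mul_smul', h]
  | basis a =>
  have h : (1 : CompAlgebra k P) * basis k P a =
      ∑ i ∈ (PartialComp.ids : Finset P), basis k P i * basis k P a := by
    simp [one_def, mul_def]
  rw [h, Finset.sum_eq_single (PartialComp.lid a)]
  · rw [basis_mul_basis, PartialComp.lid_comp, ofOption_some]
  · intro i hi hne
    rw [basis_mul_basis]
    by_cases hc : PartialComp.comp i a = none
    · rw [hc, ofOption_none]
    · exact absurd (PartialComp.eq_lid i hi a hc) hne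
  · intro h'; exact absurd (PartialComp.lid_mem a) h'

lemma mul_one' (x : CompAlgebra k P) : x * 1 = x := by
  induction x using induction_on with
  | zero => simp [zero_mul']
  | add x₁ x₂ h₁ h₂ => simp [add_mul', h₁, h₂]
  | smul c x h => simp [smul_mul', h]
  | basis a =>
  have h : basis k P a * (1 : CompAlgebra k P) =
      ∑ i ∈ (PartialComp.ids : Finset P), basis k P a * basis k P i := by
    simp [one_def, mul_def]
  rw [h, Finset.sum_eq_single (PartialComp.rid a)]
  · rw [basis_mul_basis, PartialComp.comp_rid, ofOption_some]
  · intro i hi hne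
    rw [basis_mul_basis]
    by_cases hc : PartialComp.comp a i = none
    · rw [hc, ofOption_none]
    · exact absurd (PartialComp.eq_rid i hi a hc) hne
  · intro h'; exact absurd (PartialComp.rid_mem a) h'

noncomputable instance : Ring (CompAlgebra k P) where
  __ := (inferInstance : AddCommGroup (CompAlgebra k P))
  mul_assoc := mul_assoc' k
  one_mul := one_mul' k
  mul_one := mul_one' k
  left_distrib := mul_add' k
  right_distrib := add_mul' k
  zero_mul := zero_mul' k
  mul_zero := mul_zero' k

noncomputable instance : Algebra k (CompAlgebra k P) :=
  Algebra.ofModule (smul_mul' k) (fun c x y => mul_smul' k c x y)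

end CompAlgebra

/-! ### Path algebras -/

section Paths

variable (V : Type*) [Quiver V]

/-- A path of arbitrary length in the quiver `V`, from `src` to `tgt`. -/
structure QPath where
  src : V
  tgt : V
  path : Quiver.Path src tgt

end Paths

namespace QPath

variable {V : Type*} [Quiver V]

/-- The number of arrows in a path. -/
def length (a : QPath V) : ℕ := a.path.length

/-- The trivial path at a vertex. -/
def nil (i : V) : QPath V := ⟨i, i, .nil⟩

/-- The path of length one formed by an arrow. -/
def arrow (p : Quiver.Total V) : QPath V := ⟨p.left, p.right, p.hom.toPath⟩

/-- Concatenation of paths, read from left to right. -/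
def comp (a b : QPath V) (h : a.tgt = b.src) : QPath V :=
  ⟨a.src, b.tgt, a.path.comp (b.path.cast h.symm rfl)⟩

@[simp] lemma length_nil (i : V) : (nil i).length = 0 := rfl
@[simp] lemma src_nil (i : V) : (nil i).src = i := rfl
@[simp] lemma tgt_nil (i : V) : (nil i).tgt = i := rfl
@[simp] lemma src_comp (a b : QPath V) (h : a.tgt = b.src) : (a.comp b h).src = a.src := rfl
@[simp] lemma tgt_comp (a b : QPath V) (h : a.tgt = b.src) : (a.comp b h).tgt = b.tgt := rfl

@[simp] lemma length_comp (a b : QPath V) (h : a.tgt = b.src) :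
    (a.comp b h).length = a.length + b.length := by
  obtain ⟨_, v, p⟩ := a
  obtain ⟨v', _, q⟩ := b
  change v = v' at h
  subst h
  simp [comp, length]

@[simp] lemma nil_comp (a : QPath V) (i : V) (h : i = a.src) : (nil i).comp a h = a := by
  subst h; simp [comp, nil]

@[simp] lemma comp_nil (a : QPath V) (i : V) (h : a.tgt = i) : a.comp (nil i) h = a := by
  subst h; simp [comp, nil]

lemma comp_assoc (a b c : QPath V) (h : a.tgt = b.src) (h' : b.tgt = c.src) :
    (a.comp b h).comp c h' = a.comp (b.comp c h') h := by
  obtain ⟨_, v, p⟩ := a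
  obtain ⟨v', w, q⟩ := b
  obtain ⟨w', _, r⟩ := c
  change v = v' at h
  change w = w' at h'
  subst h
  subst h'
  simp [comp]

lemma eq_nil_of_length (a : QPath V) (h : a.length = 0) : a = nil a.src := by
  obtain ⟨u, v, p⟩ := a
  cases p with
  | nil => rfl
  | cons p e => simp [length] at h

lemma comp_inj_aux {u w : V} : ∀ {v v' : V} (p : Quiver.Path u v) (q : Quiver.Path v w)
    (p' : Quiver.Path u v') (q' : Quiver.Path v' w), q.length = q'.length →
    p.comp q = p'.comp q' → (⟨u, v, p⟩ : QPath V) = ⟨u, v', p'⟩ ∧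
      (⟨v, w, q⟩ : QPath V) = ⟨v', w, q'⟩ := by
  intro v v' p q p' q' hl h
  induction q with
  | nil =>
    cases q' with
    | nil => simp at h; simp [h]
    | cons q' e => simp at hl
  | cons q e ih =>
    cases q' with
    | nil => simp at hl
    | cons q' e' =>
      simp only [Quiver.Path.comp_cons] at h
      obtain rfl := Quiver.Path.obj_eq_of_cons_eq_cons h
      have h1 := eq_of_heq (Quiver.Path.heq_of_cons_eq_cons h)
      have h2 := eq_of_heq (Quiver.Path.hom_heq_of_cons_eq_cons h)
      obtain ⟨i1, i2⟩ := ih q' (by simpa using hl) h1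
      subst h2
      refine ⟨i1, ?_⟩
      simp only [QPath.mk.injEq] at i2 ⊢
      obtain ⟨rfl, -, i3⟩ := i2
      simp at i3
      simp [i3]

lemma comp_inj {a b a' b' : QPath V} {h : a.tgt = b.src} {h' : a'.tgt = b'.src}
    (hl : a.length = a'.length) (he : a.comp b h = a'.comp b' h') : a = a' ∧ b = b' := by
  have hl' : b.length = b'.length := by
    have := congrArg length he
    simp at this; omega
  obtain ⟨u, v, p⟩ := a
  obtain ⟨v1, w, q⟩ := b
  obtain ⟨u', v', p'⟩ := a'
  obtain ⟨v1', w', q'⟩ := b'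
  obtain rfl : v = v1 := h
  obtain rfl : v' = v1' := h'
  simp only [comp, QPath.mk.injEq] at he
  obtain ⟨rfl, rfl, he⟩ := he
  exact comp_inj_aux p q p' q' hl' (by simpa using he)

lemma exists_eq_comp (c : QPath V) (m n : ℕ) (hc : c.length = m + n) :
    ∃ a b : QPath V, ∃ h : a.tgt = b.src, a.length = m ∧ b.length = n ∧ c = a.comp b h := by
  obtain ⟨u, w, p⟩ := c
  obtain ⟨v, p₁, p₂, hp, hl⟩ := p.exists_eq_comp_of_le_length (n := m) (by simp [length] at hc; omega)
  subst hp
  refine ⟨⟨u, v, p₁⟩, ⟨v, w, p₂⟩, rfl, hl, ?_, by simp [comp]⟩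
  simp [length] at hc ⊢
  omega

instance finite_length [Finite V] [∀ i j : V, Finite (i ⟶ j)] (n : ℕ) :
    Finite {a : QPath V // a.length = n} := by
  induction n with
  | zero =>
    refine Finite.of_surjective (fun i : V => (⟨nil i, rfl⟩ : {a : QPath V // a.length = 0})) ?_
    rintro ⟨a, ha⟩
    exact ⟨a.src, Subtype.ext (eq_nil_of_length a ha).symm⟩
  | succ n ih =>
    let f : ((a : {a : QPath V // a.length = n}) × (j : V) × (a.1.tgt ⟶ j)) →
        {a : QPath V // a.length = n + 1} := fun x =>
      ⟨⟨x.1.1.src, x.2.1, x.1.1.path.cons x.2.2⟩, by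
        have := x.1.2; simp [length] at this ⊢; exact this⟩
    refine Finite.of_surjective f ?_
    rintro ⟨⟨u, w, p⟩, hp⟩
    cases p with
    | nil => simp [length] at hp
    | cons p e => exact ⟨⟨⟨⟨u, _, p⟩, by simpa [length] using hp⟩, w, e⟩, rfl⟩

noncomputable instance [Finite V] [∀ i j : V, Finite (i ⟶ j)] (n : ℕ) :
    Fintype {a : QPath V // a.length = n} := Fintype.ofFinite _

open Classical in
/-- Two paths compose if the first ends where the second starts. -/
noncomputable def compOption (a b : QPath V) : Option (QPath V) :=
  if h : a.tgt = b.src then some (a.comp b h) else none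

noncomputable instance [Finite V] : PartialComp (QPath V) where
  comp := compOption
  ids := (Set.finite_range nil).toFinset
  lid a := nil a.src
  rid a := nil a.tgt
  assoc a b c := by
    by_cases h : a.tgt = b.src <;> by_cases h' : b.tgt = c.src <;> simp [compOption, h, h']
    exact comp_assoc a b c h h'
  lid_mem a := by simp
  rid_mem a := by simp
  lid_comp a := (dif_pos (tgt_nil _)).trans (congrArg some (nil_comp _ _ rfl))
  comp_rid a := (dif_pos (src_nil _).symm).trans (congrArg some (comp_nil _ _ rfl))
  eq_lid i hi a h := by
    obtain ⟨j, rfl⟩ : ∃ j, nil j = i := by simpa using hi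
    by_cases hj : j = a.src
    · rw [hj]
    · exact absurd (dif_neg hj) h
  eq_rid i hi a h := by
    obtain ⟨j, rfl⟩ : ∃ j, nil j = i := by simpa using hi
    by_cases hj : a.tgt = j
    · rw [hj]
    · exact absurd (dif_neg hj) h

lemma mem_ids [Finite V] (a : QPath V) :
    a ∈ (PartialComp.ids : Finset (QPath V)) ↔ ∃ i, nil i = a :=
  (Set.finite_range nil).mem_toFinset

section Sum

variable [Finite V] [∀ i j : V, Finite (i ⟶ j)] {M : Type*} [AddCommMonoid M]

open Classical in
lemma sum_comp (m n : ℕ) (f : QPath V → M) :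
    ∑ c : {c : QPath V // c.length = m + n}, f c =
      ∑ c : {c : QPath V // c.length = m}, ∑ c' : {c : QPath V // c.length = n},
        if h : c.1.tgt = c'.1.src then f (c.1.comp c'.1 h) else 0 := by
  rw [← Fintype.sum_prod_type', Finset.sum_dite, Finset.sum_const_zero, add_zero]
  symm
  refine Finset.sum_bij (fun x _ => ⟨x.1.1.1.comp x.1.2.1 (Finset.mem_filter.1 x.2).2, by
    simp [x.1.1.2, x.1.2.2]⟩) (fun _ _ => Finset.mem_univ _) ?_ ?_ (fun _ _ => rfl)
  · rintro ⟨⟨⟨a, ha⟩, ⟨b, hb⟩⟩, h⟩ - ⟨⟨⟨a', ha'⟩, ⟨b', hb'⟩⟩, h'⟩ - he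
    obtain ⟨rfl, rfl⟩ := comp_inj (h := (Finset.mem_filter.1 h).2) (h' := (Finset.mem_filter.1 h').2)
      (ha.trans ha'.symm) (Subtype.ext_iff.1 he)
    rfl
  · rintro ⟨c, hc⟩ -
    obtain ⟨a, b, h, ha, hb, rfl⟩ := exists_eq_comp c m n hc
    exact ⟨⟨⟨⟨a, ha⟩, ⟨b, hb⟩⟩, Finset.mem_filter.2 ⟨Finset.mem_univ _, h⟩⟩,
      Finset.mem_attach _ _, rfl⟩

lemma sum_length_zero [Fintype V] (f : QPath V → M) :
    ∑ c : {c : QPath V // c.length = 0}, f c = ∑ i : V, f (nil i) := by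
  symm
  refine Finset.sum_bij (fun i _ => ⟨nil i, rfl⟩) (fun _ _ => Finset.mem_univ _) ?_ ?_
    (fun _ _ => rfl)
  · intro i _ j _ h
    exact congrArg (fun x => x.1.src) h
  · rintro ⟨c, hc⟩ -
    exact ⟨c.src, Finset.mem_univ _, Subtype.ext (eq_nil_of_length c hc).symm⟩

end Sum

end QPath

/-- The path algebra `kQ` of a quiver `Q` with finite vertex set `V`, spanned by all paths. -/
abbrev PathAlgebra (k V : Type*) [Field k] [Quiver V] := CompAlgebra k (QPath V)

/-! ### The face algebra -/

section Face

variable (V : Type*) [Quiver V]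

/-- A pair of paths of the same length. -/
structure FacePair where
  left : QPath V
  right : QPath V
  length_eq : left.length = right.length

end Face

lemma FacePair.ext' {V : Type*} [Quiver V] {x y : FacePair V} (h : x.left = y.left)
    (h' : x.right = y.right) : x = y := by
  cases x; cases y; cases h; cases h'; rfl

/-- Pairs of paths compose componentwise. -/
def FacePair.comp {V : Type*} [Quiver V] (x y : FacePair V)
    (h : x.left.tgt = y.left.src ∧ x.right.tgt = y.right.src) : FacePair V :=
  ⟨x.left.comp y.left h.1, x.right.comp y.right h.2, by simp [x.length_eq, y.length_eq]⟩

/-- The pair of trivial paths at two vertices. -/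
def FacePair.nil {V : Type*} [Quiver V] (i j : V) : FacePair V :=
  ⟨QPath.nil i, QPath.nil j, rfl⟩

open Classical in
/-- Pairs of paths compose if both components do. -/
noncomputable def FacePair.compOption {V : Type*} [Quiver V] (x y : FacePair V) :
    Option (FacePair V) :=
  if h : x.left.tgt = y.left.src ∧ x.right.tgt = y.right.src then some (x.comp y h) else none

noncomputable instance {V : Type*} [Quiver V] [Finite V] : PartialComp (FacePair V) where
  comp := FacePair.compOption
  ids := (Set.finite_range fun i : V × V => FacePair.nil i.1 i.2).toFinset
  lid x := .nil x.left.src x.right.src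
  rid x := .nil x.left.tgt x.right.tgt
  assoc a b c := by
    by_cases h : a.left.tgt = b.left.src ∧ a.right.tgt = b.right.src <;>
    by_cases h' : b.left.tgt = c.left.src ∧ b.right.tgt = c.right.src <;>
    simp [h, h', FacePair.compOption, FacePair.comp]
    exact ⟨QPath.comp_assoc .., QPath.comp_assoc ..⟩
  lid_mem x := by simp
  rid_mem x := by simp
  lid_comp x := (dif_pos ⟨rfl, rfl⟩).trans <| congrArg some <|
    FacePair.ext' (QPath.nil_comp _ _ rfl) (QPath.nil_comp _ _ rfl)
  comp_rid x := (dif_pos ⟨rfl, rfl⟩).trans <| congrArg some <|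
    FacePair.ext' (QPath.comp_nil _ _ rfl) (QPath.comp_nil _ _ rfl)
  eq_lid i hi a h := by
    obtain ⟨j, j', rfl⟩ : ∃ j j', FacePair.nil j j' = i := by simpa using hi
    by_cases hj : j = a.left.src ∧ j' = a.right.src
    · rw [hj.1, hj.2]
    · exact absurd (dif_neg hj) h
  eq_rid i hi a h := by
    obtain ⟨j, j', rfl⟩ : ∃ j j', FacePair.nil j j' = i := by simpa using hi
    by_cases hj : a.left.tgt = j ∧ a.right.tgt = j'
    · rw [hj.1, hj.2]
    · exact absurd (dif_neg hj) h

open Classical in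
lemma FacePair.comp_def {V : Type*} [Quiver V] [Finite V] (x y : FacePair V) :
    PartialComp.comp x y =
      if h : x.left.tgt = y.left.src ∧ x.right.tgt = y.right.src then some (x.comp y h) else none := by
  change FacePair.compOption x y = _
  rw [FacePair.compOption]

lemma FacePair.mem_ids {V : Type*} [Quiver V] [Finite V] (x : FacePair V) :
    x ∈ (PartialComp.ids : Finset (FacePair V)) ↔ ∃ i j, FacePair.nil i j = x := by
  refine (Set.finite_range fun i : V × V => FacePair.nil i.1 i.2).mem_toFinset.trans ?_
  simp

/-- Hayashi's face algebra of a quiver, spanned by the elements `x_{a,b}` for pairs of paths `a, b`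
of the same length. -/
abbrev FaceAlgebra (k V : Type*) [Field k] [Quiver V] := CompAlgebra k (FacePair V)

namespace FaceAlgebra

open CompAlgebra Coalgebra

variable (k : Type*) [Field k] {V : Type*} [Quiver V]

open Classical in
/-- The element `x_{a,b}` for two paths `a, b` of the same length. -/
noncomputable def face (a b : QPath V) : FaceAlgebra k V :=
  if h : a.length = b.length then basis k _ ⟨a, b, h⟩ else 0

lemma face_eq {a b : QPath V} (h : a.length = b.length) : face k a b = basis k _ ⟨a, b, h⟩ :=
  dif_pos h

lemma basis_eq (x : FacePair V) : basis k _ x = face k x.left x.right :=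
  (face_eq k x.length_eq).symm

lemma induction_face {p : FaceAlgebra k V → Prop} (x : FaceAlgebra k V)
    (face : ∀ a b : QPath V, a.length = b.length → p (face k a b)) (zero : p 0)
    (add : ∀ x y, p x → p y → p (x + y)) (smul : ∀ (c : k) x, p x → p (c • x)) : p x :=
  CompAlgebra.induction_on k x (fun a => basis_eq k a ▸ face _ _ a.length_eq) zero add smul

lemma hom_ext_face {M : Type*} [AddCommGroup M] [Module k M] {f g : FaceAlgebra k V →ₗ[k] M}
    (h : ∀ a b : QPath V, a.length = b.length → f (face k a b) = g (face k a b)) : f = g :=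
  (basis k _).ext fun x => by rw [basis_eq]; exact h _ _ x.length_eq

open Classical in
variable (V) in
/-- The counit `x_{a,b} ↦ δ_{a,b}`. -/
noncomputable def counitMap : FaceAlgebra k V →ₗ[k] k :=
  (basis k _).constr k fun x => if x.left = x.right then 1 else 0

open Classical in
lemma counitMap_face (a b : QPath V) :
    counitMap k V (face k a b) = if a = b then 1 else 0 := by
  by_cases h : a.length = b.length
  · rw [face_eq k h, counitMap, Module.Basis.constr_basis]
  · rw [face, dif_neg h, map_zero, if_neg]
    rintro rfl; exact h rfl

section Eval

variable {B : Type*} [Ring B] (X₀ : V → V → B)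
  (X₁ : Quiver.Total V → Quiver.Total V → B)

/-- The product of the elements `X₁ pᵢ qᵢ` over the arrows of two paths of the same length. -/
def eval {u u' : V} : ∀ {v v' : V}, Quiver.Path u v → Quiver.Path u' v' → B
  | _, _, .nil, .nil => X₀ u u'
  | _, _, .cons p e, .cons q f => eval p q * X₁ ⟨_, _, e⟩ ⟨_, _, f⟩
  | _, _, .nil, .cons _ _ => 0
  | _, _, .cons _ _, .nil => 0

variable [DecidableEq V]

lemma eval_mul_right
    (h₀ : ∀ i j i' j', X₀ i j * X₀ i' j' = if i = i' ∧ j = j' then X₀ i j else 0)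
    (hr : ∀ p q, X₁ p q * X₀ p.right q.right = X₁ p q)
    {u u' v v' : V} (p : Quiver.Path u v) (q : Quiver.Path u' v') :
    eval X₀ X₁ p q * X₀ v v' = eval X₀ X₁ p q := by
  cases p <;> cases q <;> simp only [eval, zero_mul, h₀, mul_assoc]
  · simp
  · rename_i e _ _ f
    rw [hr ⟨_, _, e⟩ ⟨_, _, f⟩]

lemma eval_mul_left
    (h₀ : ∀ i j i' j', X₀ i j * X₀ i' j' = if i = i' ∧ j = j' then X₀ i j else 0)
    {u u' v v' : V} (p : Quiver.Path u v) (q : Quiver.Path u' v') :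
    X₀ u u' * eval X₀ X₁ p q = eval X₀ X₁ p q := by
  induction p generalizing v' with
  | nil => cases q <;> simp [eval, h₀]
  | cons p e ih => cases q <;> simp [eval, ← mul_assoc, ih]

lemma eval_comp
    (h₀ : ∀ i j i' j', X₀ i j * X₀ i' j' = if i = i' ∧ j = j' then X₀ i j else 0)
    (hr : ∀ p q, X₁ p q * X₀ p.right q.right = X₁ p q)
    {u u' v v' w w' : V} (p : Quiver.Path u v) (q : Quiver.Path u' v')
    (p' : Quiver.Path v w) (q' : Quiver.Path v' w') (h : p'.length = q'.length) :
    eval X₀ X₁ (p.comp p') (q.comp q') = eval X₀ X₁ p q * eval X₀ X₁ p' q' := by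
  induction p' generalizing w' with
  | nil =>
    cases q' with
    | nil => simp [eval, eval_mul_right X₀ X₁ h₀ hr]
    | cons q' f => simp at h
  | cons p' e ih =>
    cases q' with
    | nil => simp at h
    | cons q' f => simp [eval, ← mul_assoc, ih q' (by simpa using h)]

end Eval

variable [Finite V]

open Classical in
lemma face_mul {a b a' b' : QPath V} (h : a.length = b.length) (h' : a'.length = b'.length) :
    face k a b * face k a' b' =
      if H : a.tgt = a'.src ∧ b.tgt = b'.src then face k (a.comp a' H.1) (b.comp b' H.2) else 0 := by
  rw [face_eq k h, face_eq k h', basis_mul_basis, FacePair.comp_def]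
  by_cases H : a.tgt = a'.src ∧ b.tgt = b'.src
  · rw [dif_pos H, dif_pos H, face_eq k (by simp [h, h'])]
    rfl
  · rw [dif_neg H, dif_neg H]
    rfl

lemma one_eq [Fintype V] : (1 : FaceAlgebra k V) =
    ∑ i : V, ∑ j : V, face k (QPath.nil i) (QPath.nil j) := by
  classical
  rw [one_def, ← Fintype.sum_prod_type']
  symm
  refine Finset.sum_bij (fun i _ => FacePair.nil i.1 i.2) (fun i _ => ?_) (fun i _ j _ h => ?_)
    (fun x hx => ?_) (fun i _ => ?_)
  · exact (FacePair.mem_ids _).2 ⟨_, _, rfl⟩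
  · simp only [FacePair.nil, FacePair.mk.injEq, QPath.nil, QPath.mk.injEq] at h
    exact Prod.ext h.1.1 h.2.1
  · obtain ⟨j, j', rfl⟩ : ∃ j j', FacePair.nil j j' = x := (FacePair.mem_ids x).1 hx
    exact ⟨(j, j'), Finset.mem_univ _, rfl⟩
  · exact (face_eq k (a := QPath.nil i.1) (b := QPath.nil i.2) rfl).symm

/-! The face algebra is the algebra with generators `x_{i,j}` (for vertices `i, j`) and `x_{p,q}`
(for arrows `p, q`) and the relations `∑ x_{i,j} = 1`, `x_{i,j} x_{i',j'} = δ_{i,i'} δ_{j,j'} x_{i,j}`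
and `x_{s(p),s(q)} x_{p,q} = x_{p,q} = x_{p,q} x_{t(p),t(q)}`. -/

section Presentation

open Classical in
lemma relations : (∀ i j i' j' : V, face k (.nil i) (.nil j) * face k (.nil i') (.nil j') =
      if i = i' ∧ j = j' then face k (QPath.nil i) (.nil j) else 0) ∧
    ∀ p q : Quiver.Total V,
      face k (.nil p.left) (.nil q.left) * face k (.arrow p) (.arrow q) =
        face k (.arrow p) (.arrow q) ∧
      face k (.arrow p) (.arrow q) * face k (.nil p.right) (.nil q.right) =
        face k (.arrow p) (.arrow q) := by
  refine ⟨fun i j i' j' => ?_, fun p q => ⟨?_, ?_⟩⟩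
  · rw [face_mul k (a := .nil i) (b := .nil j) (a' := .nil i') (b' := .nil j') rfl rfl]
    by_cases H : i = i' ∧ j = j'
    · obtain ⟨rfl, rfl⟩ := H
      rw [dif_pos ⟨rfl, rfl⟩, if_pos ⟨rfl, rfl⟩]
      exact congrArg₂ (face k) (QPath.nil_comp (QPath.nil i) i rfl)
        (QPath.nil_comp (QPath.nil j) j rfl)
    · rw [if_neg H, dif_neg]
      exact H
  · rw [face_mul k (a := .nil p.left) (b := .nil q.left) (a' := .arrow p)
      (b' := .arrow q) rfl rfl, dif_pos ⟨rfl, rfl⟩]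
    exact congrArg₂ (face k) (QPath.nil_comp (.arrow p) _ rfl) (QPath.nil_comp (.arrow q) _ rfl)
  · rw [face_mul k (a := .arrow p) (b := .arrow q) (a' := .nil p.right)
      (b' := .nil q.right) rfl rfl, dif_pos ⟨rfl, rfl⟩]
    exact congrArg₂ (face k) (QPath.comp_nil (.arrow p) _ rfl) (QPath.comp_nil (.arrow q) _ rfl)

theorem existsUnique_algHom {B : Type*} [Ring B] [Algebra k B] [Fintype V] [DecidableEq V]
    (X₀ : V → V → B) (X₁ : Quiver.Total V → Quiver.Total V → B)
    (h₀ : ∀ i j i' j', X₀ i j * X₀ i' j' = if i = i' ∧ j = j' then X₀ i j else 0)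
    (hl : ∀ p q, X₀ p.left q.left * X₁ p q = X₁ p q)
    (hr : ∀ p q, X₁ p q * X₀ p.right q.right = X₁ p q)
    (h₁ : ∑ i, ∑ j, X₀ i j = 1) :
    ∃! f : FaceAlgebra k V →ₐ[k] B, (∀ i j, f (face k (.nil i) (.nil j)) = X₀ i j) ∧
      ∀ p q, f (face k (.arrow p) (.arrow q)) = X₁ p q := by
  let F : FaceAlgebra k V →ₗ[k] B :=
    (basis k _).constr k fun x => eval X₀ X₁ x.left.path x.right.path
  have hF (a b : QPath V) (h : a.length = b.length) :
      F (face k a b) = eval X₀ X₁ a.path b.path := by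
    rw [face_eq k h, Module.Basis.constr_basis]
  have hmul (x y : FaceAlgebra k V) : F (x * y) = F x * F y := by
    induction x using induction_face with
    | zero => simp
    | add x₁ x₂ h₁ h₂ => rw [add_mul, map_add, map_add, h₁, h₂, add_mul]
    | smul c x h => rw [smul_mul_assoc, map_smul, map_smul, h, smul_mul_assoc]
    | face a b h =>
    induction y using induction_face with
    | zero => simp
    | add x₁ x₂ h₁ h₂ => rw [mul_add, map_add, map_add, h₁, h₂, mul_add]
    | smul c x h => rw [mul_smul_comm, map_smul, map_smul, h, mul_smul_comm]
    | face a' b' h' =>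
    rw [face_mul k h h', hF a b h, hF a' b' h']
    split_ifs with H
    · obtain ⟨u, v, p⟩ := a
      obtain ⟨u', v', q⟩ := b
      obtain ⟨w, x, p'⟩ := a'
      obtain ⟨w', x', q'⟩ := b'
      change v = w ∧ v' = w' at H
      obtain ⟨H1, H2⟩ := H
      subst H1 H2
      rw [hF _ _ (by simp [h, h'])]
      exact eval_comp X₀ X₁ h₀ hr p q p' q' h'
    · rw [← eval_mul_right X₀ X₁ h₀ hr a.path, ← eval_mul_left X₀ X₁ h₀ a'.path, mul_assoc,
        ← mul_assoc (X₀ _ _) (X₀ _ _), h₀, if_neg H, zero_mul, mul_zero, map_zero]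
  have hone : F 1 = 1 := by
    rw [one_eq, map_sum, ← h₁]
    refine Finset.sum_congr rfl fun i _ => ?_
    rw [map_sum]
    exact Finset.sum_congr rfl fun j _ => hF (.nil i) (.nil j) rfl
  have hX₁ (p q) : eval X₀ X₁ (QPath.arrow p).path (QPath.arrow q).path = X₁ p q :=
    hl p q
  refine ⟨AlgHom.ofLinearMap F hone hmul, ⟨fun i j => hF (.nil i) (.nil j) rfl, fun p q =>
    (hF (.arrow p) (.arrow q) rfl).trans (hX₁ p q)⟩, ?_⟩
  rintro g ⟨hg₀, hg₁⟩
  have hg {u u' v v' : V} (p : Quiver.Path u v) (q : Quiver.Path u' v') (h : p.length = q.length) :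
      g (face k ⟨u, v, p⟩ ⟨u', v', q⟩) = eval X₀ X₁ p q := by
    induction p generalizing v' with
    | nil =>
      cases q with
      | nil => exact hg₀ u u'
      | cons q f => simp at h
    | @cons v w p e ih =>
      cases q with
      | nil => simp at h
      | @cons y _ q f =>
        have h' : p.length = q.length := by simpa using h
        have := face_mul k (a := ⟨u, v, p⟩) (b := ⟨u', y, q⟩) (a' := .arrow ⟨v, w, e⟩)
          (b' := .arrow ⟨y, v', f⟩) h' rfl
        rw [dif_pos ⟨rfl, rfl⟩] at this
        change _ = face k ⟨u, w, p.cons e⟩ ⟨u', v', q.cons f⟩ at this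
        rw [← this, map_mul, ih q h', hg₁]
        rfl
  refine AlgHom.toLinearMap_injective (hom_ext_face k fun a b h => ?_)
  exact (hg a.path b.path h).trans (hF a b h).symm

end Presentation

variable [∀ i j : V, Finite (i ⟶ j)]

open scoped TensorProduct

/-- The coproduct `x_{a,b} ↦ ∑_c x_{a,c} ⊗ x_{c,b}`, over the paths `c` of the same length. -/
noncomputable def comulMap : FaceAlgebra k V →ₗ[k] FaceAlgebra k V ⊗[k] FaceAlgebra k V :=
  (basis k _).constr k fun x =>
    ∑ c : {c : QPath V // c.length = x.left.length}, face k x.left c ⊗ₜ[k] face k c x.right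

lemma comulMap_face {n : ℕ} {a b : QPath V} (h : a.length = n) (h' : b.length = n) :
    comulMap k (face k a b) =
      ∑ c : {c : QPath V // c.length = n}, face k a c ⊗ₜ[k] face k c b := by
  subst h
  rw [face_eq k h'.symm, comulMap, Module.Basis.constr_basis]

noncomputable instance : Coalgebra k (FaceAlgebra k V) where
  comul := comulMap k
  counit := counitMap k V
  coassoc := hom_ext_face k fun a b h => by
    have h1 (c : {c : QPath V // c.length = a.length}) := comulMap_face k (a := a) rfl c.2
    have h2 (c : {c : QPath V // c.length = a.length}) := comulMap_face k c.2 h.symm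
    simp only [LinearMap.comp_apply, comulMap_face k rfl h.symm, map_sum, LinearMap.rTensor_tmul,
      LinearMap.lTensor_tmul, h1, h2, TensorProduct.sum_tmul, TensorProduct.tmul_sum,
      LinearEquiv.coe_coe, TensorProduct.assoc_tmul]
    exact Finset.sum_comm
  rTensor_counit_comp_comul := hom_ext_face k fun a b h => by
    simp only [LinearMap.comp_apply, comulMap_face k h rfl, map_sum, LinearMap.rTensor_tmul,
      counitMap_face, TensorProduct.mk_apply]
    rw [Finset.sum_eq_single ⟨a, h⟩]
    · simp
    · rintro ⟨c, hc⟩ - hne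
      rw [if_neg (fun e => hne (Subtype.ext e.symm)), TensorProduct.zero_tmul]
    · simp
  lTensor_counit_comp_comul := hom_ext_face k fun a b h => by
    simp only [LinearMap.comp_apply, comulMap_face k h rfl, map_sum, LinearMap.lTensor_tmul,
      counitMap_face, TensorProduct.mk_apply, LinearMap.flip_apply]
    rw [Finset.sum_eq_single ⟨b, rfl⟩]
    · simp
    · rintro ⟨c, hc⟩ - hne
      rw [if_neg (fun e => hne (Subtype.ext e)), TensorProduct.tmul_zero]
    · simp

lemma comul_face {n : ℕ} {a b : QPath V} (h : a.length = n) (h' : b.length = n) :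
    comul (R := k) (face k a b) =
      ∑ c : {c : QPath V // c.length = n}, face k a c ⊗ₜ[k] face k c b :=
  comulMap_face k h h'

open Classical in
lemma counit_face (a b : QPath V) :
    counit (R := k) (face k a b) = if a = b then 1 else 0 :=
  counitMap_face k a b

open Classical in
lemma counit_face_mul {a b a' b' : QPath V} (h : a.length = b.length)
    (h' : a'.length = b'.length) :
    counit (R := k) (face k a b * face k a' b') =
      if a = b ∧ a' = b' ∧ a.tgt = a'.src then 1 else 0 := by
  rw [face_mul k h h']
  by_cases H : a.tgt = a'.src ∧ b.tgt = b'.src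
  · rw [dif_pos H, counit_face]
    refine if_congr ⟨fun e => ?_, ?_⟩ rfl rfl
    · obtain ⟨h1, h2⟩ := QPath.comp_inj h e
      exact ⟨h1, h2, H.1⟩
    · rintro ⟨rfl, rfl, -⟩; rfl
  · rw [dif_neg H, map_zero, if_neg]
    rintro ⟨rfl, rfl, e⟩
    exact H ⟨e, e⟩

open Classical in
lemma counit_face_mul_mul {p q a b r s : QPath V} (h₁ : p.length = q.length)
    (h₂ : a.length = b.length) (h₃ : r.length = s.length) :
    counit (R := k) (face k p q * face k a b * face k r s) =
      if p = q ∧ a = b ∧ r = s ∧ p.tgt = a.src ∧ a.tgt = r.src then 1 else 0 := by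
  rw [face_mul k h₁ h₂]
  by_cases H : p.tgt = a.src ∧ q.tgt = b.src
  · rw [dif_pos H, counit_face_mul k (by simp [h₁, h₂]) h₃]
    refine if_congr ⟨fun e => ?_, ?_⟩ rfl rfl
    · obtain ⟨h1, h2⟩ := QPath.comp_inj h₁ e.1
      exact ⟨h1, h2, e.2.1, H.1, e.2.2⟩
    · rintro ⟨rfl, rfl, rfl, -, h⟩; exact ⟨rfl, rfl, h⟩
  · rw [dif_neg H, zero_mul, map_zero, if_neg]
    rintro ⟨rfl, rfl, -, e, -⟩
    exact H ⟨e, e⟩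

lemma comul_mul' (x y : FaceAlgebra k V) :
    comul (R := k) (x * y) = comul x * comul y := by
  induction x using induction_face with
  | zero => simp
  | add x₁ x₂ h₁ h₂ => simp [add_mul, h₁, h₂]
  | smul c x h => rw [smul_mul_assoc, map_smul, map_smul, h, smul_mul_assoc]
  | face a b h =>
  induction y using induction_face with
  | zero => simp
  | add x₁ x₂ h₁ h₂ => simp [mul_add, h₁, h₂]
  | smul c x h => rw [mul_smul_comm, map_smul, map_smul, h, mul_smul_comm]
  | face a' b' h' =>
  have h1 (c : {c : QPath V // c.length = a.length})
      (c' : {c : QPath V // c.length = a'.length}) :=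
    face_mul k (a := a) (a' := a') c.2.symm c'.2.symm
  have h2 (c : {c : QPath V // c.length = a.length})
      (c' : {c : QPath V // c.length = a'.length}) :=
    face_mul k (b := b) (b' := b') (c.2.trans h) (c'.2.trans h')
  rw [face_mul k h h', comul_face k rfl h.symm, comul_face k rfl h'.symm, Finset.sum_mul_sum]
  simp only [Algebra.TensorProduct.tmul_mul_tmul, h1, h2]
  by_cases H : a.tgt = a'.src ∧ b.tgt = b'.src
  · rw [dif_pos H, comul_face k (n := a.length + a'.length) (by simp) (by simp [h, h']),
      QPath.sum_comp a.length a'.length (fun c => face k (a.comp a' H.1) c ⊗ₜ[k]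
        face k c (b.comp b' H.2))]
    refine Finset.sum_congr rfl fun c _ => Finset.sum_congr rfl fun c' _ => ?_
    by_cases hc : c.1.tgt = c'.1.src
    · rw [dif_pos hc, dif_pos ⟨H.1, hc⟩, dif_pos ⟨hc, H.2⟩]
    · rw [dif_neg hc, dif_neg (fun e => hc e.2), TensorProduct.zero_tmul]
  · rw [dif_neg H, map_zero]
    symm
    refine Finset.sum_eq_zero fun c _ => Finset.sum_eq_zero fun c' _ => ?_
    by_cases H1 : a.tgt = a'.src
    · rw [dif_neg (c := c.1.tgt = c'.1.src ∧ b.tgt = b'.src) (fun e => H ⟨H1, e.2⟩),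
        TensorProduct.tmul_zero]
    · rw [dif_neg (fun e => H1 e.1), TensorProduct.zero_tmul]

open Classical in
lemma counit_mul_mul' (x y z : FaceAlgebra k V) :
    counit (R := k) (x * y * z) = LinearMap.mul' k k
      (TensorProduct.map (counit ∘ₗ LinearMap.mulLeft k x) (counit ∘ₗ LinearMap.mulRight k z)
        (comul y)) := by
  induction y using induction_face with
  | zero => simp
  | add x₁ x₂ h₁ h₂ => simp only [mul_add, add_mul, map_add, h₁, h₂]
  | smul c x h => simp only [mul_smul_comm, smul_mul_assoc, map_smul, h]
  | face a b h =>
  simp only [comul_face k rfl h.symm, map_sum, TensorProduct.map_tmul, LinearMap.mul'_apply,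
    LinearMap.comp_apply, LinearMap.mulLeft_apply, LinearMap.mulRight_apply]
  induction x using induction_face with
  | zero => simp
  | add x₁ x₂ h₁ h₂ => simp only [add_mul, map_add, h₁, h₂, Finset.sum_add_distrib]
  | smul c x h => 
    rw [smul_mul_assoc, smul_mul_assoc, map_smul, h, smul_eq_mul, Finset.mul_sum]
    simp only [smul_mul_assoc, map_smul, smul_eq_mul, mul_assoc]
  | face p q h' =>
  induction z using induction_face with
  | zero => simp
  | add x₁ x₂ h₁ h₂ => simp only [mul_add, map_add, h₁, h₂, Finset.sum_add_distrib]
  | smul c x h =>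
    simp only [mul_smul_comm, map_smul, h, smul_eq_mul, Finset.mul_sum, mul_left_comm]
  | face r s h'' =>
  rw [counit_face_mul_mul k h' h h'', Finset.sum_eq_single ⟨a, rfl⟩, counit_face_mul k h' rfl,
    counit_face_mul k h h'']
  · rw [ite_zero_mul_ite_zero, mul_one]
    refine if_congr ?_ rfl rfl
    tauto
  · rintro ⟨c, hc⟩ - hne
    rw [counit_face_mul k h' hc.symm, if_neg, zero_mul]
    rintro ⟨-, e, -⟩
    exact hne (Subtype.ext e.symm)
  · simp

open Classical in
lemma counit_mul_mul_swap' (x y z : FaceAlgebra k V) :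
    counit (R := k) (x * y * z) = LinearMap.mul' k k
      (TensorProduct.map (counit ∘ₗ LinearMap.mulLeft k x) (counit ∘ₗ LinearMap.mulRight k z)
        (TensorProduct.comm k _ _ (comul y))) := by
  induction y using induction_face with
  | zero => simp
  | add x₁ x₂ h₁ h₂ => simp only [mul_add, add_mul, map_add, h₁, h₂]
  | smul c x h => simp only [mul_smul_comm, smul_mul_assoc, map_smul, h]
  | face a b h =>
  simp only [comul_face k rfl h.symm, map_sum, TensorProduct.map_tmul, LinearMap.mul'_apply,
    LinearMap.comp_apply, LinearMap.mulLeft_apply, LinearMap.mulRight_apply,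
    TensorProduct.comm_tmul]
  induction x using induction_face with
  | zero => simp
  | add x₁ x₂ h₁ h₂ => simp only [add_mul, map_add, h₁, h₂, Finset.sum_add_distrib]
  | smul c x h => 
    rw [smul_mul_assoc, smul_mul_assoc, map_smul, h, smul_eq_mul, Finset.mul_sum]
    simp only [smul_mul_assoc, map_smul, smul_eq_mul, mul_assoc]
  | face p q h' =>
  induction z using induction_face with
  | zero => simp
  | add x₁ x₂ h₁ h₂ => simp only [mul_add, map_add, h₁, h₂, Finset.sum_add_distrib]
  | smul c x h =>
    simp only [mul_smul_comm, map_smul, h, smul_eq_mul, Finset.mul_sum, mul_left_comm]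
  | face r s h'' =>
  rw [counit_face_mul_mul k h' h h'', Finset.sum_eq_single ⟨a, rfl⟩, counit_face_mul k h' h,
    counit_face_mul k rfl h'']
  · rw [ite_zero_mul_ite_zero, mul_one]
    refine if_congr ?_ rfl rfl
    tauto
  · rintro ⟨c, hc⟩ - hne
    rw [counit_face_mul k (a := a) hc.symm h'', if_neg (c := a = c ∧ _), mul_zero]
    rintro ⟨e, -⟩
    exact hne (Subtype.ext e.symm)
  · simp

section One

variable [Fintype V]

variable (V) in
lemma comul_one_eq : comul (R := k) (1 : FaceAlgebra k V) =
    ∑ l : V, (∑ i : V, face k (.nil i) (.nil l)) ⊗ₜ[k] (∑ j : V, face k (.nil l) (.nil j)) := by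
  have h (i j : V) : comul (R := k) (face k (.nil i) (.nil j)) =
      ∑ l : V, face k (QPath.nil i) (.nil l) ⊗ₜ[k] face k (.nil l) (.nil j) := by
    rw [comul_face k (n := 0) rfl rfl]
    exact QPath.sum_length_zero fun c => face k (QPath.nil i) c ⊗ₜ[k] face k c (QPath.nil j)
  simp only [one_eq, map_sum, h, TensorProduct.sum_tmul, TensorProduct.tmul_sum]
  exact (Finset.sum_congr rfl fun i _ => Finset.sum_comm).trans <| Finset.sum_comm.trans <|
    Finset.sum_congr rfl fun l _ => Finset.sum_comm

lemma left_mul_right (l m : V) :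
    (∑ j : V, face k (QPath.nil l) (.nil j)) * (∑ i : V, face k (QPath.nil i) (.nil m)) =
      face k (.nil l) (.nil m) := by
  classical
  simp [Finset.sum_mul_sum, (relations k).1, ite_and]

lemma right_mul_left (l m : V) :
    (∑ i : V, face k (QPath.nil i) (.nil m)) * (∑ j : V, face k (QPath.nil l) (.nil j)) =
      face k (.nil l) (.nil m) := by
  classical
  simp [Finset.sum_mul_sum, (relations k).1, ite_and]

lemma comul_left (l : V) : comul (R := k) (∑ j : V, face k (QPath.nil l) (.nil j)) =
    ∑ m : V, face k (QPath.nil l) (.nil m) ⊗ₜ[k] (∑ j : V, face k (QPath.nil m) (.nil j)) := by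
  have h (i j : V) : comul (R := k) (face k (.nil i) (.nil j)) =
      ∑ l : V, face k (QPath.nil i) (.nil l) ⊗ₜ[k] face k (.nil l) (.nil j) := by
    rw [comul_face k (n := 0) rfl rfl]
    exact QPath.sum_length_zero fun c => face k (QPath.nil i) c ⊗ₜ[k] face k c (QPath.nil j)
  simp only [map_sum, h, TensorProduct.tmul_sum]
  exact Finset.sum_comm

end One

set_option synthInstance.maxHeartbeats 200000 in
noncomputable instance : WeakBialgebra k (FaceAlgebra k V) where
  comul_mul := comul_mul' k
  counit_mul_mul := counit_mul_mul' k
  counit_mul_mul_swap := counit_mul_mul_swap' k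
  comul_one := by
    have := Fintype.ofFinite V
    classical
    rw [comul_one_eq, TensorProduct.sum_tmul, map_sum, map_sum, TensorProduct.tmul_sum,
      Finset.sum_mul_sum]
    refine Finset.sum_congr rfl fun l _ => ?_
    rw [LinearMap.lTensor_tmul, comul_left, TensorProduct.tmul_sum]
    refine Finset.sum_congr rfl fun m _ => ?_
    rw [TensorProduct.assoc_tmul, Algebra.TensorProduct.tmul_mul_tmul,
      Algebra.TensorProduct.tmul_mul_tmul, mul_one, one_mul, left_mul_right]
  comul_one_swap := by
    have := Fintype.ofFinite V
    classical
    rw [comul_one_eq, TensorProduct.sum_tmul, map_sum, map_sum, TensorProduct.tmul_sum,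
      Finset.sum_mul_sum, Finset.sum_comm]
    refine Finset.sum_congr rfl fun l _ => ?_
    rw [LinearMap.lTensor_tmul, comul_left, TensorProduct.tmul_sum]
    refine Finset.sum_congr rfl fun m _ => ?_
    rw [TensorProduct.assoc_tmul, Algebra.TensorProduct.tmul_mul_tmul,
      Algebra.TensorProduct.tmul_mul_tmul, mul_one, one_mul, right_mul_left]

end FaceAlgebra


/-! ### The grading of the path algebra by path length -/

section Grading

open CompAlgebra

variable (k : Type*) [Field k] (V : Type*) [Quiver V]

/-- The span of the paths of length `n`. -/
noncomputable def pathGrading (n : ℕ) : Submodule k (PathAlgebra k V) :=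
  Submodule.span k (Set.range fun a : {a : QPath V // a.length = n} => basis k (QPath V) a.1)

variable {V} in
lemma basis_mem_pathGrading (a : QPath V) : basis k _ a ∈ pathGrading k V a.length :=
  Submodule.subset_span ⟨⟨a, rfl⟩, rfl⟩

/-- The basis of the degree `n` part of the path algebra formed by the paths of length `n`. -/
noncomputable def pathBasis (n : ℕ) :
    Module.Basis {a : QPath V // a.length = n} k (pathGrading k V n) :=
  Module.Basis.span ((basis k (QPath V)).linearIndependent.comp _ Subtype.val_injective)

@[simp] lemma coe_pathBasis (n : ℕ) (a : {a : QPath V // a.length = n}) :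
    (pathBasis k V n a : PathAlgebra k V) = basis k _ a.1 :=
  Module.Basis.coe_span_apply _ _

variable [Finite V]

open Classical in
lemma basis_mul_basis_path (a b : QPath V) : basis k _ a * basis k _ b =
    if h : a.tgt = b.src then basis k (QPath V) (a.comp b h) else 0 := by
  rw [basis_mul_basis]
  change ofOption k (QPath.compOption a b) = _
  rw [QPath.compOption]
  split_ifs <;> rfl

instance : SetLike.GradedMonoid (pathGrading k V) where
  one_mem := by
    rw [one_def]
    refine Submodule.sum_mem _ fun i hi => ?_
    obtain ⟨j, rfl⟩ := (QPath.mem_ids i).1 hi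
    exact basis_mem_pathGrading k (QPath.nil j)
  mul_mem m n x y hx hy := by
    refine Submodule.span_induction₂ (p := fun x y _ _ => x * y ∈ pathGrading k V (m + n))
      ?_ ?_ ?_ ?_ ?_ ?_ ?_ hx hy
    · rintro _ _ ⟨⟨a, rfl⟩, rfl⟩ ⟨⟨b, rfl⟩, rfl⟩
      change basis k _ a * basis k _ b ∈ _
      rw [basis_mul_basis_path]
      split_ifs with h
      · rw [← QPath.length_comp a b h]
        exact basis_mem_pathGrading k _
      · exact Submodule.zero_mem _
    · intro y _; rw [zero_mul]; exact Submodule.zero_mem _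
    · intro x _; rw [mul_zero]; exact Submodule.zero_mem _
    · intro x y z _ _ _ h h'; rw [add_mul]; exact Submodule.add_mem _ h h'
    · intro x y z _ _ _ h h'; rw [mul_add]; exact Submodule.add_mem _ h h'
    · intro c x y _ _ h; rw [smul_mul_assoc]; exact Submodule.smul_mem _ _ h
    · intro c x y _ _ h; rw [mul_smul_comm]; exact Submodule.smul_mem _ _ h

noncomputable instance : DirectSum.Decomposition (pathGrading k V) :=
  DirectSum.Decomposition.ofLinearMap (pathGrading k V)
    ((basis k (QPath V)).constr k fun a =>
      DirectSum.lof k ℕ (fun n => pathGrading k V n) a.length ⟨_, basis_mem_pathGrading k a⟩)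
    ((basis k (QPath V)).ext fun a => by
      rw [LinearMap.comp_apply, Module.Basis.constr_basis, DirectSum.coeLinearMap_lof]; rfl)
    (DirectSum.linearMap_ext _ fun n => (pathBasis k V n).ext fun a => by
      obtain ⟨a, rfl⟩ := a
      rw [LinearMap.comp_apply, LinearMap.comp_apply, DirectSum.coeLinearMap_lof, coe_pathBasis,
        Module.Basis.constr_basis, LinearMap.comp_apply, LinearMap.id_apply]
      congr 1
      exact Subtype.ext (coe_pathBasis k V _ ⟨a, rfl⟩).symm)

noncomputable instance : GradedAlgebra (pathGrading k V) where

end Grading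

/-! ### Comodule algebras over weak bialgebras -/

open Coalgebra

section Counital

variable (k H : Type*) [Field k] [Ring H] [WeakBialgebra k H]

/-- The source counital map `x ↦ 1₁ ε(x 1₂)`. -/
noncomputable def sourceMap : H →ₗ[k] H where
  toFun x := TensorProduct.rid k H ((counit ∘ₗ LinearMap.mulLeft k x).lTensor H (comul (1 : H)))
  map_add' x y := by
    rw [show LinearMap.mulLeft k (x + y) = LinearMap.mulLeft k x + LinearMap.mulLeft k y by
      ext; simp [add_mul], LinearMap.comp_add, LinearMap.lTensor_add, LinearMap.add_apply, map_add]
  map_smul' c x := by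
    rw [show LinearMap.mulLeft k (c • x) = c • LinearMap.mulLeft k x by ext; simp,
      LinearMap.comp_smul, LinearMap.lTensor_smul, LinearMap.smul_apply, map_smul, RingHom.id_apply]

/-- The target counital map `x ↦ ε(1₁ x) 1₂`. -/
noncomputable def targetMap : H →ₗ[k] H where
  toFun x := TensorProduct.lid k H ((counit ∘ₗ LinearMap.mulRight k x).rTensor H (comul (1 : H)))
  map_add' x y := by
    rw [show LinearMap.mulRight k (x + y) = LinearMap.mulRight k x + LinearMap.mulRight k y by
      ext; simp [mul_add], LinearMap.comp_add, LinearMap.rTensor_add, LinearMap.add_apply, map_add]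
  map_smul' c x := by
    rw [show LinearMap.mulRight k (c • x) = c • LinearMap.mulRight k x by ext; simp,
      LinearMap.comp_smul, LinearMap.rTensor_smul, LinearMap.smul_apply, map_smul, RingHom.id_apply]

/-- The source counital subalgebra `H_s`, as a subspace. -/
noncomputable def sourceCounital : Submodule k H := LinearMap.range (sourceMap k H)

/-- The target counital subalgebra `H_t`, as a subspace. -/
noncomputable def targetCounital : Submodule k H := LinearMap.range (targetMap k H)

end Counital

section Comodule

variable {k H M : Type*} [Field k] [Ring H] [WeakBialgebra k H] [AddCommGroup M] [Module k M]

/-- `lam` is a left `H`-comodule structure on `M`. -/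
structure IsLeftComodule (lam : M →ₗ[k] H ⊗[k] M) : Prop where
  coassoc : (TensorProduct.assoc k H H M).toLinearMap ∘ₗ comul.rTensor M ∘ₗ lam =
    lam.lTensor H ∘ₗ lam
  counit : (TensorProduct.lid k M).toLinearMap ∘ₗ counit.rTensor M ∘ₗ lam = LinearMap.id

/-- `rho` is a right `H`-comodule structure on `M`. -/
structure IsRightComodule (rho : M →ₗ[k] M ⊗[k] H) : Prop where
  coassoc : (TensorProduct.assoc k M H H).toLinearMap ∘ₗ rho.rTensor H ∘ₗ rho =
    comul.lTensor M ∘ₗ rho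
  counit : (TensorProduct.rid k M).toLinearMap ∘ₗ counit.lTensor M ∘ₗ rho = LinearMap.id

/-- `lamN` is the restriction of `lam : M → H ⊗ M` to a map `N → H ⊗ N`. -/
def LeftRestricts (lam : M →ₗ[k] H ⊗[k] M) (N : Submodule k M) (lamN : N →ₗ[k] H ⊗[k] N) : Prop :=
  lam ∘ₗ N.subtype = N.subtype.lTensor H ∘ₗ lamN

/-- `rhoN` is the restriction of `rho : M → M ⊗ H` to a map `N → N ⊗ H`. -/
def RightRestricts (rho : M →ₗ[k] M ⊗[k] H) (N : Submodule k M) (rhoN : N →ₗ[k] N ⊗[k] H) : Prop :=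
  rho ∘ₗ N.subtype = N.subtype.rTensor H ∘ₗ rhoN

end Comodule

section ComoduleAlgebra

variable {k H A : Type*} [Field k] [Ring H] [WeakBialgebra k H] [Ring A] [Algebra k A]

/-- The algebra `A` is a left `H`-comodule algebra via `lam`. -/
structure IsLeftComoduleAlgebra (lam : A →ₗ[k] H ⊗[k] A) : Prop extends IsLeftComodule lam where
  map_mul : ∀ a b : A, lam (a * b) = lam a * lam b
  map_one_mem : lam 1 ∈ LinearMap.range ((sourceCounital k H).subtype.rTensor A)

/-- The algebra `A` is a right `H`-comodule algebra via `rho`. -/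
structure IsRightComoduleAlgebra (rho : A →ₗ[k] A ⊗[k] H) : Prop extends
    IsRightComodule rho where
  map_mul : ∀ a b : A, rho (a * b) = rho a * rho b
  map_one_mem : rho 1 ∈ LinearMap.range ((targetCounital k H).subtype.lTensor A)

variable (𝒜 : ℕ → Submodule k A) [GradedAlgebra 𝒜]

/-- The graded algebra `A` is a left `H`-comodule algebra via `lam`, the coaction is linear (it
restricts to a comodule structure on each graded component), and `A₀ ≅ H_t` as left
`H`-comodule algebras: there is an isomorphism of algebras `ψ` from `A₀` onto `H_t` which
intertwines the restriction of `lam` to `A₀` with the restriction of `Δ` to `H_t`. -/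
structure IsLeftBasePreserving (lam : A →ₗ[k] H ⊗[k] A) : Prop extends
    IsLeftComoduleAlgebra lam where
  linear : ∀ i, ∃ lamᵢ : 𝒜 i →ₗ[k] H ⊗[k] 𝒜 i, LeftRestricts lam (𝒜 i) lamᵢ ∧ IsLeftComodule lamᵢ
  base : ∃ lam₀ : 𝒜 0 →ₗ[k] H ⊗[k] 𝒜 0, LeftRestricts lam (𝒜 0) lam₀ ∧
    ∃ ψ : 𝒜 0 →ₐ[k] H, Function.Injective ψ ∧ LinearMap.range ψ.toLinearMap = targetCounital k H ∧
      ∀ a, comul (R := k) (ψ a) = ψ.toLinearMap.lTensor H (lam₀ a)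

/-- The graded algebra `A` is a right `H`-comodule algebra via `rho`, the coaction is linear, and
`A₀ ≅ H_s` as right `H`-comodule algebras. -/
structure IsRightBasePreserving (rho : A →ₗ[k] A ⊗[k] H) : Prop extends
    IsRightComoduleAlgebra rho where
  linear : ∀ i, ∃ rhoᵢ : 𝒜 i →ₗ[k] 𝒜 i ⊗[k] H, RightRestricts rho (𝒜 i) rhoᵢ ∧ IsRightComodule rhoᵢ
  base : ∃ rho₀ : 𝒜 0 →ₗ[k] 𝒜 0 ⊗[k] H, RightRestricts rho (𝒜 0) rho₀ ∧
    ∃ φ : 𝒜 0 →ₐ[k] H, Function.Injective φ ∧ LinearMap.range φ.toLinearMap = sourceCounital k H ∧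
      ∀ a, comul (R := k) (φ a) = φ.toLinearMap.rTensor H (rho₀ a)

/-- The coactions `lam` and `rho` are transposed with respect to a homogeneous basis `v` of `A`:
`lam (v_j) = ∑ z_{j,k} ⊗ v_k` and `rho (v_j) = ∑ v_k ⊗ z_{k,j}` in each degree, for the same
elements `z_{j,k}` of `H`. -/
def IsTransposed {𝒜 : ℕ → Submodule k A} {ι : ℕ → Type*} [∀ i, Fintype (ι i)]
    (v : ∀ i, Module.Basis (ι i) k (𝒜 i)) (lam : A →ₗ[k] H ⊗[k] A) (rho : A →ₗ[k] A ⊗[k] H) :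
    Prop :=
  ∀ i, ∃ z : ι i → ι i → H, ∀ j,
    lam (v i j) = ∑ l, z j l ⊗ₜ[k] (v i l : A) ∧ rho (v i j) = ∑ l, (v i l : A) ⊗ₜ[k] z l j

end ComoduleAlgebra

/-! ### Universal quantum linear semigroupoids -/

section Universal

universe w x u v

variable {k : Type u} {A : Type v} [Field k] [Ring A] [Algebra k A] (𝒜 : ℕ → Submodule k A)
  [GradedAlgebra 𝒜]

/-- The weak bialgebra `O` with the left coaction `lam` on `A` is a left universal quantum linear
semigroupoid of `A` (tested against the weak bialgebras in the universe `w`). Weak bialgebra maps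
are maps of algebras and of coalgebras. -/
structure IsLeftUQSGd (O : Type x) [Ring O] [WeakBialgebra k O] (lam : A →ₗ[k] O ⊗[k] A) :
    Prop where
  coacts : IsLeftBasePreserving 𝒜 lam
  universal : ∀ (H : Type w) [Ring H] [WeakBialgebra k H] (lamH : A →ₗ[k] H ⊗[k] A),
    IsLeftBasePreserving 𝒜 lamH →
      ∃! π : O →ₐc[k] H, (π : O →ₗ[k] H).rTensor A ∘ₗ lam = lamH

/-- The weak bialgebra `O` with the right coaction `rho` on `A` is a right universal quantum linear
semigroupoid of `A`. -/
structure IsRightUQSGd (O : Type x) [Ring O] [WeakBialgebra k O] (rho : A →ₗ[k] A ⊗[k] O) :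
    Prop where
  coacts : IsRightBasePreserving 𝒜 rho
  universal : ∀ (H : Type w) [Ring H] [WeakBialgebra k H] (rhoH : A →ₗ[k] A ⊗[k] H),
    IsRightBasePreserving 𝒜 rhoH →
      ∃! π : O →ₐc[k] H, (π : O →ₗ[k] H).lTensor A ∘ₗ rho = rhoH

variable {𝒜} in
/-- The weak bialgebra `O` with the coactions `lam`, `rho` on `A`, transposed with respect to the
homogeneous basis `v`, is a transposed universal quantum linear semigroupoid of `A`. -/
structure IsTransUQSGd {ι : ℕ → Type*} [∀ i, Fintype (ι i)] (v : ∀ i, Module.Basis (ι i) k (𝒜 i))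
    (O : Type x) [Ring O] [WeakBialgebra k O] (lam : A →ₗ[k] O ⊗[k] A) (rho : A →ₗ[k] A ⊗[k] O) :
    Prop where
  coacts_left : IsLeftBasePreserving 𝒜 lam
  coacts_right : IsRightBasePreserving 𝒜 rho
  transposed : IsTransposed v lam rho
  universal : ∀ (H : Type w) [Ring H] [WeakBialgebra k H] (lamH : A →ₗ[k] H ⊗[k] A)
    (rhoH : A →ₗ[k] A ⊗[k] H), IsLeftBasePreserving 𝒜 lamH → IsRightBasePreserving 𝒜 rhoH →
      IsTransposed v lamH rhoH →
      ∃! π : O →ₐc[k] H, (π : O →ₗ[k] H).rTensor A ∘ₗ lam = lamH ∧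
        (π : O →ₗ[k] H).lTensor A ∘ₗ rho = rhoH

end Universal

/-! ### The standard coactions of the face algebra on the path algebra -/

namespace FaceAlgebra

variable (k : Type*) [Field k] (V : Type*) [Quiver V] [Finite V] [∀ i j : V, Finite (i ⟶ j)]

/-- The standard left coaction `a ↦ ∑_b x_{a,b} ⊗ b`, over the paths `b` of the same length. -/
noncomputable def leftCoaction : PathAlgebra k V →ₗ[k] FaceAlgebra k V ⊗[k] PathAlgebra k V :=
  (CompAlgebra.basis k _).constr k fun a =>
    ∑ b : {b : QPath V // b.length = a.length}, face k a b ⊗ₜ[k] CompAlgebra.basis k _ b.1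

/-- The standard right coaction `a ↦ ∑_b b ⊗ x_{b,a}`, over the paths `b` of the same length. -/
noncomputable def rightCoaction : PathAlgebra k V →ₗ[k] PathAlgebra k V ⊗[k] FaceAlgebra k V :=
  (CompAlgebra.basis k _).constr k fun a =>
    ∑ b : {b : QPath V // b.length = a.length}, CompAlgebra.basis k _ b.1 ⊗ₜ[k] face k b a

end FaceAlgebra

end UQSGd

open UQSGd

/-!
A base preserving left coaction of a weak bialgebra `H` on `kQ` is a matrix `z a b`, indexed by pairs
of paths of the same length, with `λ(a) = ∑ z a b ⊗ b`. The comodule axioms say that `z a b` has the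
coproduct and counit of the element `x_{a,b}` of the face algebra, and multiplicativity of `λ` says
that `z` is multiplicative under concatenation. As the face algebra is presented by generators and
relations, a map of weak bialgebras to `H` with `x_{a,b} ↦ z a b` exists, and is then the only one
compatible with the coactions, as soon as the `z i j` at vertices are orthogonal idempotents with
sum one (`IsFaceMatrix.exists_bialgHom`).

Multiplicativity gives this orthogonality only for equal second indices. The rest is
`vertex_relations`, and comes from base preservation. Let `y i` be the image of `e_i` in `H_t`. Then
`Δ 1 = ∑ s j ⊗ y j`, where `s j = ∑ i, z i j`, and comparing `Δ (y i) = ∑ z i j ⊗ y j` with the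
formula `Δ (y) = (y ⊗ 1) Δ 1` for `y` in `H_t` gives `z i j = y i * s j`. The `y i` are orthogonal
idempotents because `kQ₀ ≅ H_t` is an algebra map; weak multiplicativity of the counit makes the
`s j` orthogonal.

Right coactions are treated by the same lemma, with the opposite coproduct. In the transposed case
the two coactions have the same matrix, so the map for the left coaction serves for both. Conversely
the standard coactions are base preserving: `H_t` and `H_s` of the face algebra are spanned by the
row sums and the column sums of the `x_{i,j}`. Isomorphism of universal objects is formal.
-/

namespace UQSGd

open Coalgebra
open scoped TensorProduct

/-! ### Orthogonality of the vertex matrix over a weak bialgebra -/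

section VertexRelations

variable {k H ι : Type*} [Field k] [Ring H] [Algebra k H] [Fintype ι] [DecidableEq ι]

/-- Elements `y j` with a dual family of functionals have unique coefficients in `M ⊗ N`. -/
lemma eq_of_sum_tmul_eq {M N : Type*} [AddCommGroup M] [Module k M] [AddCommGroup N] [Module k N]
    {y : ι → N} {g : ι → N →ₗ[k] k}
    (hg : ∀ i j, g i (y j) = if j = i then 1 else 0) {u v : ι → M}
    (h : ∑ j, u j ⊗ₜ[k] y j = ∑ j, v j ⊗ₜ[k] y j) (i : ι) : u i = v i := by
  have := congrArg (fun t => TensorProduct.rid k M ((g i).lTensor M t)) h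
  simpa [hg, Finset.sum_ite_eq'] using this

/-- The entries `z i j` of the vertex matrix of a base preserving coaction are orthogonal idempotents
with sum one. Here `y i` are the images of the trivial paths in the counital subalgebra, and `h₁`,
`h₂` say that `Δ y = (y ⊗ 1) Δ 1 = (1₁ y) ⊗ 1₂` for `y` in that subalgebra. The map `Δ` is the
coproduct for a left coaction and the opposite coproduct for a right coaction, which is why the
axioms used are passed as hypotheses rather than through `WeakBialgebra`.

Writing `s j` for the `j`-th column sum, `z i j = y i * s j = s j * y i` and `Δ 1 = ∑ s j ⊗ y j`.
The two counit axioms then give `s i * s j = ε (s i * s j) • s i = ε (s i * s j) • s j`, so that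
distinct `s j` are orthogonal. -/
lemma vertex_relations (Δ : H →ₗ[k] H ⊗[k] H) (ε : H →ₗ[k] k)
    (hΔ : ∀ a b, Δ (a * b) = Δ a * Δ b)
    (hΔε : ∀ a, TensorProduct.rid k H (ε.lTensor H (Δ a)) = a)
    (hε₁ : ∀ a b, ε (a * b) = LinearMap.mul' k k
      (TensorProduct.map (ε ∘ₗ LinearMap.mulLeft k a) (ε ∘ₗ LinearMap.mulRight k b) (Δ 1)))
    (hε₂ : ∀ a b, ε (a * b) = LinearMap.mul' k k
      (TensorProduct.map (ε ∘ₗ LinearMap.mulLeft k a) (ε ∘ₗ LinearMap.mulRight k b)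
        (TensorProduct.comm k H H (Δ 1))))
    {y : ι → H} {z : ι → ι → H} {g : ι → H →ₗ[k] k}
    (hg : ∀ i j, g i (y j) = if j = i then 1 else 0)
    (hy : ∀ i j, y i * y j = if i = j then y i else 0) (hy₁ : ∑ i, y i = 1)
    (hΔy : ∀ i, Δ (y i) = ∑ j, z i j ⊗ₜ[k] y j)
    (hΔz : ∀ i j, Δ (z i j) = ∑ c, z i c ⊗ₜ[k] z c j)
    (hεz : ∀ i j, ε (z i j) = if i = j then 1 else 0)
    (hzz : ∀ i i' j, z i j * z i' j = if i = i' then z i j else 0)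
    (h₁ : ∀ i, Δ (y i) = ∑ m, (y i * ∑ l, z l m) ⊗ₜ[k] y m)
    (h₂ : ∀ i, Δ (y i) = ∑ m, ((∑ l, z l m) * y i) ⊗ₜ[k] y m) :
    (∀ i j i' j', z i j * z i' j' = if i = i' ∧ j = j' then z i j else 0) ∧
      ∑ i, ∑ j, z i j = 1 := by
  set s : ι → H := fun m => ∑ l, z l m with hs
  have hzs (i j) : z i j = y i * s j := eq_of_sum_tmul_eq hg ((hΔy i).symm.trans (h₁ i)) j
  have hzs' (i j) : z i j = s j * y i := eq_of_sum_tmul_eq hg ((hΔy i).symm.trans (h₂ i)) j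
  have hcomm (i j) : y i * s j = s j * y i := (hzs i j).symm.trans (hzs' i j)
  have hΔ1 : Δ 1 = ∑ j, s j ⊗ₜ[k] y j := by
    rw [← hy₁, map_sum]
    simp only [hΔy, hs, TensorProduct.sum_tmul]
    exact Finset.sum_comm
  have hΔs (j) : Δ (s j) = ∑ c, s c ⊗ₜ[k] (y c * s j) := by
    simp only [hs, map_sum, hΔz, TensorProduct.sum_tmul]
    rw [Finset.sum_comm]
    refine Finset.sum_congr rfl fun c _ => Finset.sum_congr rfl fun i _ => ?_
    rw [hzs c j]
  have hss (j) : s j * s j = s j := by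
    have aux (i) : z i j * s j = z i j := by
      simp only [hs, Finset.mul_sum, hzz]
      simp
    conv_lhs => rw [hs]
    simp only [Finset.sum_mul]
    exact Finset.sum_congr rfl fun i _ => aux i
  have hεs (j) : ε (s j) = 1 := by simp [hs, hεz]
  have hεys (i j) : ε (y i * s j) = if i = j then 1 else 0 := by rw [← hzs, hεz]
  have hεsy (i j) : ε (s j * y i) = if i = j then 1 else 0 := by rw [← hzs', hεz]
  have hA (a b) : ε (a * b) = ∑ m, ε (a * s m) * ε (y m * b) := by simp [hε₁ a b, hΔ1]
  have hB (a b) : ε (a * b) = ∑ m, ε (a * y m) * ε (s m * b) := by simp [hε₂ a b, hΔ1]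
  -- Products of the `s j` stay in the span of the `s j`.
  have hspan (i j) : s i * s j = ∑ c, ε (y c * (s i * s j)) • s c := by
    have h : Δ (s i * s j) = ∑ c, s c ⊗ₜ[k] (y c * (s i * s j)) := by
      rw [hΔ, hΔs, hΔs, Finset.sum_mul_sum]
      refine Finset.sum_congr rfl fun c _ => ?_
      have aux (d) : y c * s i * (y d * s j) = if c = d then y c * (s i * s j) else 0 := by
        rw [hcomm c i, mul_assoc, ← mul_assoc (y c), hy]
        split_ifs
        · rw [← mul_assoc, ← hcomm, mul_assoc]
        · simp
      simp only [Algebra.TensorProduct.tmul_mul_tmul, aux]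
      rw [Finset.sum_eq_single c]
      · rw [if_pos rfl, hss]
      · intro d _ hd
        rw [if_neg hd.symm, TensorProduct.tmul_zero]
      · simp
    conv_lhs => rw [← hΔε (s i * s j), h]
    simp
  -- Expand `ε (y c * s i * s j)` with the second counit axiom.
  have hl (i j) : s i * s j = ε (s i * s j) • s i := by
    conv_lhs => rw [hspan]
    rw [Finset.sum_eq_single i]
    · rw [← mul_assoc, hB]
      congr 1
      rw [Finset.sum_eq_single i]
      · rw [hcomm, mul_assoc, hy, if_pos rfl, hεsy, if_pos rfl, one_mul]
      · intro m _ hm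
        rw [hcomm, mul_assoc, hy, if_neg hm.symm, mul_zero, map_zero, zero_mul]
      · simp
    · intro c _ hc
      rw [← mul_assoc, hB, Finset.sum_eq_zero, zero_smul]
      intro m _
      rw [hcomm, mul_assoc, hy]
      split_ifs
      · rw [hεsy, if_neg hc, zero_mul]
      · rw [mul_zero, map_zero, zero_mul]
    · simp
  -- Expand `ε (s i * (s j * y c))` with the first counit axiom.
  have hr (i j) : s i * s j = ε (s i * s j) • s j := by
    conv_lhs => rw [hspan]
    have key (c) : ε (y c * (s i * s j)) = if c = j then ε (s i * s j) else 0 := by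
      rw [← mul_assoc, hcomm, mul_assoc, hcomm, hA]
      have aux (m) : ε (y m * (s j * y c)) = if m = c ∧ c = j then 1 else 0 := by
        rw [← mul_assoc, hcomm, mul_assoc, hy]
        split_ifs with h h' h'
        · rw [hεsy, if_pos (h.trans h'.2)]
        · rw [hεsy, if_neg (fun e => h' ⟨h, h ▸ e⟩)]
        · exact absurd h'.1 h
        · rw [mul_zero, map_zero]
      simp only [aux]
      by_cases h : c = j
      · subst h; simp
      · simp [h]
    simp [key]
  -- Comparing the two multiples after applying `ε (y i * ·)` makes the scalar zero.
  have hsij (i j) (h : i ≠ j) : s i * s j = 0 := by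
    have := congrArg (fun t => ε (y i * t)) ((hl i j).symm.trans (hr i j))
    simp only [mul_smul_comm, map_smul, hεys, if_neg h, if_pos] at this
    rw [hl, show ε (s i * s j) = 0 by simpa using this, zero_smul]
  have hss' (i j) : s i * s j = if i = j then s i else 0 := by
    split_ifs with h
    · rw [← h, hss]
    · exact hsij i j h
  have hs1 : ∑ j, s j = 1 := by
    have h1 : ∑ j, ε (y j) • s j = 1 := by
      conv_rhs => rw [← hΔε 1, hΔ1]
      simp
    -- Multiplying by `s l` and applying the counit shows that the coefficients are one.
    have h2 (l) : ε (y l) = 1 := by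
      have := congrArg (fun t => ε (t * s l)) h1
      simpa [Finset.sum_mul, hss', hεs] using this
    simpa [h2] using h1
  refine ⟨fun i j i' j' => ?_, ?_⟩
  · rw [hzs' i j, hzs i' j', mul_assoc, ← mul_assoc (y i), hy]
    by_cases h : i = i'
    · subst h
      rw [if_pos rfl, hcomm, ← mul_assoc, hss']
      by_cases h' : j = j'
      · simp [h']
      · simp [h']
    · simp [h]
  · simp only [hzs, ← Finset.mul_sum, hs1, hy₁, mul_one]

end VertexRelations

/-! ### Maps out of the face algebra -/

section FaceMatrix

variable {k V H : Type*} [Field k] [Quiver V] [Finite V] [∀ i j : V, Finite (i ⟶ j)] [Ring H]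
  [WeakBialgebra k H]

open Classical in
variable (k) in
/-- The elements `z a b` of a weak bialgebra satisfy the relations and have the coproducts and
counits of the elements `x_{a,b}` of the face algebra. Only the values at pairs of paths of the same
length are constrained. -/
structure IsFaceMatrix (z : QPath V → QPath V → H) : Prop where
  comul : ∀ {n : ℕ} {a b : QPath V}, a.length = n → b.length = n →
    comul (R := k) (z a b) = ∑ c : {c : QPath V // c.length = n}, z a c ⊗ₜ[k] z c b
  counit : ∀ {a b : QPath V}, a.length = b.length →
    counit (R := k) (z a b) = if a = b then 1 else 0
  map_comp : ∀ {a b a' b' : QPath V}, a.length = b.length → a'.length = b'.length →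
    ∀ (h : a.tgt = a'.src) (h' : b.tgt = b'.src), z (a.comp a' h) (b.comp b' h') = z a b * z a' b'
  vertex_mul : ∀ i j i' j' : V, z (.nil i) (.nil j) * z (.nil i') (.nil j') =
    if i = i' ∧ j = j' then z (.nil i) (.nil j) else 0
  vertex_sum : ∀ [Fintype V], ∑ i : V, ∑ j : V, z (.nil i) (.nil j) = 1

lemma IsFaceMatrix.exists_bialgHom {z : QPath V → QPath V → H} (hz : IsFaceMatrix k z) :
    ∃ f : FaceAlgebra k V →ₐc[k] H, ∀ a b : QPath V, a.length = b.length →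
      f (FaceAlgebra.face k a b) = z a b := by
  classical
  have := Fintype.ofFinite V
  obtain ⟨f, ⟨hf₀, hf₁⟩, -⟩ := FaceAlgebra.existsUnique_algHom k
    (fun i j : V => z (.nil i) (.nil j)) (fun p q => z (.arrow p) (.arrow q))
    (fun i j i' j' => by rw [hz.vertex_mul])
    (fun p q => by
      exact (hz.map_comp (a := .nil p.left) (b := .nil q.left) (a' := .arrow p) (b' := .arrow q)
        rfl rfl rfl rfl).symm.trans
        (congrArg₂ z (QPath.nil_comp (.arrow p) _ rfl) (QPath.nil_comp (.arrow q) _ rfl)))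
    (fun p q => by
      exact (hz.map_comp (a := .arrow p) (b := .arrow q) (a' := .nil p.right) (b' := .nil q.right)
        rfl rfl rfl rfl).symm.trans
        (congrArg₂ z (QPath.comp_nil (.arrow p) _ rfl) (QPath.comp_nil (.arrow q) _ rfl)))
    hz.vertex_sum
  have hpath {u u' v v' : V} (p : Quiver.Path u v) (q : Quiver.Path u' v')
      (h : p.length = q.length) :
      f (FaceAlgebra.face k ⟨u, v, p⟩ ⟨u', v', q⟩) = z ⟨u, v, p⟩ ⟨u', v', q⟩ := by
    induction p generalizing v' with
    | nil =>
      cases q with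
      | nil => exact hf₀ u u'
      | cons q e => simp at h
    | @cons v w p e ih =>
      cases q with
      | nil => simp at h
      | @cons y _ q e' =>
        have h' : p.length = q.length := by simpa using h
        have h₁ := FaceAlgebra.face_mul k (a := ⟨u, v, p⟩) (b := ⟨u', y, q⟩)
          (a' := .arrow ⟨v, w, e⟩) (b' := .arrow ⟨y, v', e'⟩) h' rfl
        rw [dif_pos ⟨rfl, rfl⟩] at h₁
        change _ = FaceAlgebra.face k ⟨u, w, p.cons e⟩ ⟨u', v', q.cons e'⟩ at h₁
        have h₂ := hz.map_comp (a := ⟨u, v, p⟩) (b := ⟨u', y, q⟩)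
          (a' := .arrow ⟨v, w, e⟩) (b' := .arrow ⟨y, v', e'⟩) h' rfl rfl rfl
        change z ⟨u, w, p.cons e⟩ ⟨u', v', q.cons e'⟩ = _ at h₂
        rw [← h₁, map_mul, ih q h', hf₁, h₂]
  have hf (a b : QPath V) (h : a.length = b.length) : f (FaceAlgebra.face k a b) = z a b :=
    hpath a.path b.path h
  refine ⟨{ f with
    map_smul' := map_smul f
    counit_comp := FaceAlgebra.hom_ext_face k fun a b h => ?_
    map_comp_comul := FaceAlgebra.hom_ext_face k fun a b h => ?_ }, hf⟩
  · change Coalgebra.counit (f (FaceAlgebra.face k a b)) = _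
    rw [hf a b h, hz.counit h, FaceAlgebra.counit_face]
  · change TensorProduct.map f.toLinearMap f.toLinearMap (Coalgebra.comul (FaceAlgebra.face k a b)) =
      Coalgebra.comul (f (FaceAlgebra.face k a b))
    rw [hf a b h, hz.comul h rfl, FaceAlgebra.comul_face k h rfl, map_sum]
    refine Finset.sum_congr rfl fun c _ => ?_
    rw [TensorProduct.map_tmul]
    exact congrArg₂ _ (hf _ _ (h.trans c.2.symm)) (hf _ _ c.2)

lemma bialgHom_ext_face {f g : FaceAlgebra k V →ₐc[k] H} (h : ∀ a b : QPath V,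
    a.length = b.length → f (FaceAlgebra.face k a b) = g (FaceAlgebra.face k a b)) : f = g := by
  ext x
  exact LinearMap.congr_fun (FaceAlgebra.hom_ext_face k (f := (f : FaceAlgebra k V →ₗ[k] H))
    (g := (g : FaceAlgebra k V →ₗ[k] H)) h) x

end FaceMatrix

/-! ### Coefficients of graded coactions on the path algebra -/

section Coefficients

variable {k V : Type*} [Field k] [Quiver V] {M : Type*} [AddCommGroup M] [Module k M]

/-- The coefficient in `M` of the path `b` in an element of `M ⊗ kQ`. -/
noncomputable def pathCoeff (b : QPath V) : M ⊗[k] PathAlgebra k V →ₗ[k] M :=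
  (TensorProduct.rid k M).toLinearMap ∘ₗ ((CompAlgebra.basis k (QPath V)).coord b).lTensor M

open Classical in
lemma pathCoeff_tmul_basis (b c : QPath V) (m : M) :
    pathCoeff b (m ⊗ₜ[k] CompAlgebra.basis k _ c) = if c = b then m else 0 := by
  simp [pathCoeff, Finsupp.single_apply, ite_smul]

/-- The `(a, b)` entry of the matrix of a linear map `kQ → M ⊗ kQ` in the path basis. -/
noncomputable def matrixCoeff (lam : PathAlgebra k V →ₗ[k] M ⊗[k] PathAlgebra k V)
    (a b : QPath V) : M :=
  pathCoeff b (lam (CompAlgebra.basis k _ a))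

lemma eq_sum_tmul_basis {N ι : Type*} [AddCommGroup N] [Module k N] [Fintype ι]
    (v : Module.Basis ι k N) (x : M ⊗[k] N) :
    x = ∑ i, TensorProduct.rid k M ((v.coord i).lTensor M x) ⊗ₜ[k] v i := by
  induction x using TensorProduct.induction_on with
  | zero => simp
  | tmul m n =>
    simp only [LinearMap.lTensor_tmul, TensorProduct.rid_tmul, TensorProduct.smul_tmul,
      ← TensorProduct.tmul_sum, Module.Basis.coord_apply, v.sum_repr]
  | add x y hx hy =>
    simp only [map_add, TensorProduct.add_tmul, Finset.sum_add_distrib]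
    rw [← hx, ← hy]

variable [Finite V] [∀ i j : V, Finite (i ⟶ j)]

lemma pathCoeff_sum {n : ℕ} (u : QPath V → M) {b : QPath V} (hb : b.length = n) :
    pathCoeff b (∑ c : {c : QPath V // c.length = n}, u c ⊗ₜ[k] CompAlgebra.basis k _ c.1) =
      u b := by
  classical
  simp only [map_sum, pathCoeff_tmul_basis]
  rw [Finset.sum_eq_single ⟨b, hb⟩]
  · simp
  · intro c _ hc
    rw [if_neg fun e => hc (Subtype.ext e)]
  · simp

lemma apply_basis_eq_sum {lam : PathAlgebra k V →ₗ[k] M ⊗[k] PathAlgebra k V}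
    (h : ∀ n, ∀ x ∈ pathGrading k V n,
      lam x ∈ LinearMap.range ((pathGrading k V n).subtype.lTensor M))
    {n : ℕ} {a : QPath V} (ha : a.length = n) :
    lam (CompAlgebra.basis k _ a) = ∑ b : {b : QPath V // b.length = n},
      matrixCoeff lam a b ⊗ₜ[k] CompAlgebra.basis k _ b.1 := by
  subst ha
  obtain ⟨t, ht⟩ := h _ _ (basis_mem_pathGrading k a)
  obtain ⟨u, hu⟩ : ∃ u : QPath V → M, lam (CompAlgebra.basis k _ a) =
      ∑ b : {b : QPath V // b.length = a.length}, u b ⊗ₜ[k] CompAlgebra.basis k _ b.1 := by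
    classical
    refine ⟨fun b => if hb : b.length = a.length then TensorProduct.rid k M
      (((pathBasis k V a.length).coord ⟨b, hb⟩).lTensor M t) else 0, ?_⟩
    conv_lhs => rw [← ht, eq_sum_tmul_basis (pathBasis k V a.length) t, map_sum]
    refine Finset.sum_congr rfl fun b _ => ?_
    beta_reduce
    rw [dif_pos b.2, LinearMap.lTensor_tmul, Submodule.subtype_apply, coe_pathBasis]
  rw [hu]
  refine Finset.sum_congr rfl fun b _ => ?_
  rw [matrixCoeff, hu, pathCoeff_sum u b.2]

open Classical in
/-- The coefficients of a multiplicative graded map multiply along composable pairs of paths in the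
second index, because a path splits uniquely into pieces of given lengths. -/
lemma matrixCoeff_mul {H : Type*} [Ring H] [Algebra k H]
    {lam : PathAlgebra k V →ₗ[k] H ⊗[k] PathAlgebra k V}
    (h : ∀ n, ∀ x ∈ pathGrading k V n,
      lam x ∈ LinearMap.range ((pathGrading k V n).subtype.lTensor H))
    (hmul : ∀ x y, lam (x * y) = lam x * lam y) {a b a' b' : QPath V}
    (hab : a.length = b.length) (hab' : a'.length = b'.length) (hb : b.tgt = b'.src) :
    matrixCoeff lam a b * matrixCoeff lam a' b' =
      if H : a.tgt = a'.src then matrixCoeff lam (a.comp a' H) (b.comp b' hb) else 0 := by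
  have key : pathCoeff (b.comp b' hb)
      (lam (CompAlgebra.basis k _ a * CompAlgebra.basis k _ a')) =
      matrixCoeff lam a b * matrixCoeff lam a' b' := by
    rw [hmul, apply_basis_eq_sum h hab, apply_basis_eq_sum h hab', Finset.sum_mul_sum]
    simp only [Algebra.TensorProduct.tmul_mul_tmul, basis_mul_basis_path, map_sum]
    rw [Finset.sum_eq_single ⟨b, rfl⟩, Finset.sum_eq_single ⟨b', rfl⟩]
    · rw [dif_pos hb, pathCoeff_tmul_basis, if_pos rfl]
    · rintro c - hc
      split_ifs with H
      · rw [pathCoeff_tmul_basis, if_neg]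
        exact fun e => hc (Subtype.ext (QPath.comp_inj rfl e).2)
      · simp
    · simp
    · rintro c - hc
      refine Finset.sum_eq_zero fun d _ => ?_
      split_ifs with H
      · rw [pathCoeff_tmul_basis, if_neg]
        exact fun e => hc (Subtype.ext (QPath.comp_inj c.2 e).1)
      · simp
    · simp
  rw [← key, basis_mul_basis_path]
  split_ifs with H
  · rfl
  · simp

end Coefficients

section DegreeZero

variable {k V : Type*} [Field k] [Quiver V]

variable (k) in
/-- The trivial path at `i`, as an element of the degree zero part of the path algebra. -/
noncomputable def vertexElt (i : V) : pathGrading k V 0 := pathBasis k V 0 ⟨.nil i, rfl⟩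

@[simp] lemma coe_vertexElt (i : V) :
    (vertexElt k i : PathAlgebra k V) = CompAlgebra.basis k _ (.nil i) :=
  coe_pathBasis k V 0 _

/-- An injective map on `kQ₀` sends the trivial paths to a family with dual functionals. -/
lemma exists_dual_vertexElt [DecidableEq V] {H : Type*} [AddCommGroup H] [Module k H]
    {ψ : pathGrading k V 0 →ₗ[k] H} (hψ : Function.Injective ψ) :
    ∃ g : V → H →ₗ[k] k, ∀ i j, g i (ψ (vertexElt k j)) = if j = i then 1 else 0 := by
  classical
  obtain ⟨r, hr⟩ := ψ.exists_leftInverse_of_injective (LinearMap.ker_eq_bot.2 hψ)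
  refine ⟨fun i => (pathBasis k V 0).coord ⟨.nil i, rfl⟩ ∘ₗ r, fun i j => ?_⟩
  have h : r (ψ (vertexElt k j)) = vertexElt k j := LinearMap.congr_fun hr _
  rw [LinearMap.comp_apply, h, vertexElt, Module.Basis.coord_apply, Module.Basis.repr_self,
    Finsupp.single_apply]
  refine if_congr ⟨fun e => congrArg (fun x => x.1.src) e, ?_⟩ rfl rfl
  rintro rfl; rfl

variable [Finite V]

lemma pathAlgebra_one_eq [Fintype V] :
    (1 : PathAlgebra k V) = ∑ i : V, CompAlgebra.basis k _ (QPath.nil i) := by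
  rw [CompAlgebra.one_def]
  symm
  refine Finset.sum_bij (fun i _ => QPath.nil i) (fun i _ => (QPath.mem_ids _).2 ⟨i, rfl⟩)
    (fun i _ j _ h => congrArg QPath.src h) (fun x hx => ?_) (fun _ _ => rfl)
  obtain ⟨i, rfl⟩ := (QPath.mem_ids x).1 hx
  exact ⟨i, Finset.mem_univ _, rfl⟩

lemma sum_vertexElt [Fintype V] : ∑ i : V, vertexElt k i = 1 := by
  refine Subtype.ext ?_
  rw [SetLike.GradeZero.coe_one, pathAlgebra_one_eq, AddSubmonoidClass.coe_finsetSum]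
  simp

lemma vertexElt_mul [DecidableEq V] (i j : V) :
    vertexElt k i * vertexElt k j = if i = j then vertexElt k i else 0 := by
  refine Subtype.ext ?_
  rw [SetLike.GradeZero.coe_mul, coe_vertexElt, coe_vertexElt, basis_mul_basis_path]
  by_cases h : i = j
  · subst h
    rw [if_pos rfl, dif_pos (by rfl), coe_vertexElt]
    exact congrArg _ (QPath.nil_comp (QPath.nil i) i rfl)
  · rw [if_neg h, dif_neg (by exact h)]; rfl

end DegreeZero

/-! ### Base preserving coactions give face matrices -/

section BasePreserving

variable {k V H : Type*} [Field k] [Quiver V] [Finite V] [Ring H]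
  [WeakBialgebra k H]

lemma counit_mul_eq (a b : H) : counit (R := k) (a * b) = LinearMap.mul' k k
    (TensorProduct.map (counit ∘ₗ LinearMap.mulLeft k a) (counit ∘ₗ LinearMap.mulRight k b)
      (comul (1 : H))) := by
  simpa using WeakBialgebra.counit_mul_mul (k := k) a 1 b

lemma counit_mul_eq_swap (a b : H) : counit (R := k) (a * b) = LinearMap.mul' k k
    (TensorProduct.map (counit ∘ₗ LinearMap.mulLeft k a) (counit ∘ₗ LinearMap.mulRight k b)
      (TensorProduct.comm k H H (comul (1 : H)))) := by
  simpa using WeakBialgebra.counit_mul_mul_swap (k := k) a 1 b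

section Left

variable {lam : PathAlgebra k V →ₗ[k] H ⊗[k] PathAlgebra k V}

lemma IsLeftBasePreserving.apply_mem (h : IsLeftBasePreserving (pathGrading k V) lam) (n : ℕ)
    (x : PathAlgebra k V) (hx : x ∈ pathGrading k V n) :
    lam x ∈ LinearMap.range ((pathGrading k V n).subtype.lTensor H) := by
  obtain ⟨lamₙ, hlam, -⟩ := h.linear n
  exact ⟨lamₙ ⟨x, hx⟩, (LinearMap.congr_fun hlam ⟨x, hx⟩).symm⟩

variable [∀ i j : V, Finite (i ⟶ j)]

lemma IsLeftBasePreserving.apply_basis (h : IsLeftBasePreserving (pathGrading k V) lam)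
    {n : ℕ} {a : QPath V} (ha : a.length = n) :
    lam (CompAlgebra.basis k _ a) = ∑ b : {b : QPath V // b.length = n},
      matrixCoeff lam a b ⊗ₜ[k] CompAlgebra.basis k _ b.1 :=
  apply_basis_eq_sum h.apply_mem ha

lemma IsLeftBasePreserving.comul_matrixCoeff (h : IsLeftBasePreserving (pathGrading k V) lam)
    {n : ℕ} {a b : QPath V} (ha : a.length = n) (hb : b.length = n) :
    comul (R := k) (matrixCoeff lam a b) =
      ∑ c : {c : QPath V // c.length = n}, matrixCoeff lam a c ⊗ₜ[k] matrixCoeff lam c b := by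
  have key := congrArg (fun t => pathCoeff b ((TensorProduct.assoc k H H _).symm t))
    (LinearMap.congr_fun h.coassoc (CompAlgebra.basis k _ a))
  simp only [LinearMap.comp_apply, LinearEquiv.coe_coe, LinearEquiv.symm_apply_apply,
    h.apply_basis ha, map_sum (LinearMap.rTensor _ _), map_sum (LinearMap.lTensor _ _),
    LinearMap.rTensor_tmul, LinearMap.lTensor_tmul] at key
  rw [pathCoeff_sum (fun c => comul (matrixCoeff lam a c)) hb] at key
  rw [key, map_sum, map_sum]
  refine Finset.sum_congr rfl fun c _ => ?_
  rw [h.apply_basis c.2, TensorProduct.tmul_sum, map_sum]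
  simp only [TensorProduct.assoc_symm_tmul]
  exact pathCoeff_sum (fun d => matrixCoeff lam a c ⊗ₜ[k] matrixCoeff lam c d) hb

open Classical in
lemma IsLeftBasePreserving.counit_matrixCoeff (h : IsLeftBasePreserving (pathGrading k V) lam)
    {a b : QPath V} (hab : a.length = b.length) :
    counit (R := k) (matrixCoeff lam a b) = if a = b then 1 else 0 := by
  have key := congrArg (fun t => (CompAlgebra.basis k _).coord b t)
    (LinearMap.congr_fun h.counit (CompAlgebra.basis k _ a))
  simp only [LinearMap.comp_apply, LinearEquiv.coe_coe, h.apply_basis hab, map_sum,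
    LinearMap.rTensor_tmul, TensorProduct.lid_tmul, map_smul, Module.Basis.coord_apply,
    Module.Basis.repr_self, LinearMap.id_apply] at key
  rw [Finset.sum_eq_single ⟨b, rfl⟩] at key
  · simpa [Finsupp.single_apply] using key
  · intro c _ hc
    rw [Finsupp.single_apply, if_neg fun e => hc (Subtype.ext e), smul_zero]
  · simp

/-- The isomorphism `kQ₀ ≅ H_t` supplies the hypotheses of `UQSGd.vertex_relations`: the iterated
coproduct of `1` computes the coproduct on `H_t` in two ways. -/
lemma IsLeftBasePreserving.vertex_relations [Fintype V] [DecidableEq V]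
    (h : IsLeftBasePreserving (pathGrading k V) lam) :
    (∀ i j i' j' : V, matrixCoeff lam (.nil i) (.nil j) * matrixCoeff lam (.nil i') (.nil j') =
      if i = i' ∧ j = j' then matrixCoeff lam (.nil i) (.nil j) else 0) ∧
      ∑ i : V, ∑ j : V, matrixCoeff lam (.nil i) (.nil j) = 1 := by
  obtain ⟨lam₀, hlam₀, ψ, hψ, hrange, hcomul⟩ := h.base
  obtain ⟨g, hg⟩ := exists_dual_vertexElt (ψ := ψ.toLinearMap) hψ
  simp only [AlgHom.toLinearMap_apply] at hg
  have hlamE (i : V) : lam₀ (vertexElt k i) =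
      ∑ j, matrixCoeff lam (.nil i) (.nil j) ⊗ₜ[k] vertexElt k j := by
    apply Module.Flat.lTensor_preserves_injective_linearMap (M := H) (pathGrading k V 0).subtype
      (Submodule.injective_subtype _)
    refine (LinearMap.congr_fun hlam₀ (vertexElt k i)).symm.trans ?_
    rw [LinearMap.comp_apply, Submodule.subtype_apply, coe_vertexElt, h.apply_basis (n := 0) rfl,
      map_sum]
    refine (QPath.sum_length_zero fun c => matrixCoeff lam (.nil i) c ⊗ₜ[k]
      CompAlgebra.basis k _ c).trans (Finset.sum_congr rfl fun j _ => ?_)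
    rw [LinearMap.lTensor_tmul, Submodule.subtype_apply, coe_vertexElt]
  have hΔy (i : V) : comul (R := k) (ψ (vertexElt k i)) =
      ∑ j, matrixCoeff lam (.nil i) (.nil j) ⊗ₜ[k] ψ (vertexElt k j) := by
    rw [hcomul, hlamE, map_sum]
    rfl
  have hy₁ : ∑ i, ψ (vertexElt k i) = 1 := by rw [← map_sum, sum_vertexElt, map_one]
  obtain ⟨s, hs⟩ : ∃ s : V → H, ∀ j, ∑ i, matrixCoeff lam (.nil i) (.nil j) = s j :=
    ⟨_, fun _ => rfl⟩
  have hΔ1 : comul (R := k) (1 : H) = ∑ j, s j ⊗ₜ[k] ψ (vertexElt k j) := by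
    rw [← hy₁, map_sum]
    simp only [hΔy, ← hs, TensorProduct.sum_tmul]
    exact Finset.sum_comm
  -- The elements `x i` provide functionals dual to the column sums of the vertex matrix.
  have hx (i : V) : ∃ x : H, ∀ j, counit (R := k) (s j * x) = if i = j then 1 else 0 := by
    obtain ⟨x, hx⟩ : ψ (vertexElt k i) ∈ targetCounital k H :=
      hrange ▸ LinearMap.mem_range_self ψ.toLinearMap _
    refine ⟨x, fun j => ?_⟩
    have := congrArg (g j) hx
    rw [hg] at this
    rw [← this]
    change _ = g j (TensorProduct.lid k H
      ((counit ∘ₗ LinearMap.mulRight k x).rTensor H (comul (1 : H))))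
    simp [hΔ1, hg]
  choose x hx using hx
  refine UQSGd.vertex_relations (comul (R := k)) counit WeakBialgebra.comul_mul
    (fun a => ?_) counit_mul_eq counit_mul_eq_swap hg (fun i j => ?_) hy₁ hΔy (fun i j => ?_)
    (fun i j => ?_) (fun i i' j => ?_) (fun i => ?_) (fun i => ?_)
  · rw [Coalgebra.lTensor_counit_comul]; simp
  · rw [← map_mul, vertexElt_mul]; split_ifs <;> simp
  · rw [h.comul_matrixCoeff (n := 0) rfl rfl]
    exact QPath.sum_length_zero fun c => matrixCoeff lam (.nil i) c ⊗ₜ[k]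
      matrixCoeff lam c (.nil j)
  · rw [h.counit_matrixCoeff (a := .nil i) (b := .nil j) rfl]
    classical
    exact if_congr ⟨fun e => congrArg QPath.src e, congrArg _⟩ rfl rfl
  · rw [matrixCoeff_mul h.apply_mem h.map_mul (a := .nil i) (b := .nil j) (a' := .nil i')
      (b' := .nil j) rfl rfl rfl]
    by_cases H : i = i'
    · subst H
      rw [if_pos rfl, dif_pos (by rfl)]
      exact congrArg₂ (matrixCoeff lam) (QPath.nil_comp (QPath.nil i) i rfl)
        (QPath.nil_comp (QPath.nil j) j rfl)
    · rw [if_neg H, dif_neg (by exact H)]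
  · have := congrArg (fun t => TensorProduct.lid k (H ⊗[k] H)
      ((counit ∘ₗ LinearMap.mulRight k (x i)).rTensor _ t))
      (WeakBialgebra.comul_one (k := k) (H := H))
    simpa [hs, hΔ1, TensorProduct.sum_tmul, TensorProduct.tmul_sum, Finset.sum_mul_sum, hx]
      using this
  · have := congrArg (fun t => TensorProduct.lid k (H ⊗[k] H)
      ((counit ∘ₗ LinearMap.mulRight k (x i)).rTensor _ t))
      (WeakBialgebra.comul_one_swap (k := k) (H := H))
    simpa [hs, hΔ1, TensorProduct.sum_tmul, TensorProduct.tmul_sum, Finset.sum_mul_sum, hx]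
      using this

lemma IsLeftBasePreserving.isFaceMatrix (h : IsLeftBasePreserving (pathGrading k V) lam) :
    IsFaceMatrix k (matrixCoeff lam) := by
  classical
  have := Fintype.ofFinite V
  refine ⟨h.comul_matrixCoeff, h.counit_matrixCoeff, fun hab hab' H H' => ?_, fun i j i' j' => ?_,
    h.vertex_relations.2⟩
  · rw [matrixCoeff_mul h.apply_mem h.map_mul hab hab' H', dif_pos H]
  · rw [h.vertex_relations.1]

end Left

section Right

/-- The right coaction `rho` with its tensor factors exchanged. -/
noncomputable def flipCoaction (rho : PathAlgebra k V →ₗ[k] PathAlgebra k V ⊗[k] H) :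
    PathAlgebra k V →ₗ[k] H ⊗[k] PathAlgebra k V :=
  (TensorProduct.comm k (PathAlgebra k V) H).toLinearMap ∘ₗ rho

variable {rho : PathAlgebra k V →ₗ[k] PathAlgebra k V ⊗[k] H}

lemma IsRightBasePreserving.flip_apply_mem (h : IsRightBasePreserving (pathGrading k V) rho)
    (n : ℕ) (x : PathAlgebra k V) (hx : x ∈ pathGrading k V n) :
    flipCoaction rho x ∈ LinearMap.range ((pathGrading k V n).subtype.lTensor H) := by
  obtain ⟨rhoₙ, hrho, -⟩ := h.linear n
  refine ⟨TensorProduct.comm k _ H (rhoₙ ⟨x, hx⟩), ?_⟩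
  rw [flipCoaction, LinearMap.comp_apply, show rho x = _ from LinearMap.congr_fun hrho ⟨x, hx⟩,
    LinearMap.comp_apply]
  induction rhoₙ ⟨x, hx⟩ using TensorProduct.induction_on with
  | zero => simp
  | tmul m n => simp
  | add x y hx hy => simp only [map_add, hx, hy]

lemma IsRightBasePreserving.flip_map_mul (h : IsRightBasePreserving (pathGrading k V) rho)
    (x y : PathAlgebra k V) :
    flipCoaction rho (x * y) = flipCoaction rho x * flipCoaction rho y := by
  change Algebra.TensorProduct.comm k (PathAlgebra k V) H (rho (x * y)) =
    Algebra.TensorProduct.comm k (PathAlgebra k V) H (rho x) *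
      Algebra.TensorProduct.comm k (PathAlgebra k V) H (rho y)
  rw [h.map_mul, map_mul]

variable [∀ i j : V, Finite (i ⟶ j)]

lemma IsRightBasePreserving.apply_basis (h : IsRightBasePreserving (pathGrading k V) rho)
    {n : ℕ} {a : QPath V} (ha : a.length = n) :
    rho (CompAlgebra.basis k _ a) = ∑ b : {b : QPath V // b.length = n},
      CompAlgebra.basis k _ b.1 ⊗ₜ[k] matrixCoeff (flipCoaction rho) a b := by
  apply (TensorProduct.comm k (PathAlgebra k V) H).injective
  refine (apply_basis_eq_sum h.flip_apply_mem ha).trans ?_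
  rw [map_sum]
  rfl

lemma IsRightBasePreserving.comul_matrixCoeff (h : IsRightBasePreserving (pathGrading k V) rho)
    {n : ℕ} {a b : QPath V} (ha : a.length = n) (hb : b.length = n) :
    comul (R := k) (matrixCoeff (flipCoaction rho) a b) =
      ∑ c : {c : QPath V // c.length = n},
        matrixCoeff (flipCoaction rho) c b ⊗ₜ[k] matrixCoeff (flipCoaction rho) a c := by
  have key := congrArg (fun t => pathCoeff b (TensorProduct.comm k _ _ t))
    (LinearMap.congr_fun h.coassoc (CompAlgebra.basis k _ a))
  simp only [LinearMap.comp_apply, LinearEquiv.coe_coe, h.apply_basis ha,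
    map_sum (LinearMap.rTensor _ _), map_sum (LinearMap.lTensor _ _),
    LinearMap.rTensor_tmul, LinearMap.lTensor_tmul, map_sum (TensorProduct.comm _ _ _),
    TensorProduct.comm_tmul] at key
  rw [pathCoeff_sum (fun c => comul (matrixCoeff (flipCoaction rho) a c)) hb] at key
  rw [← key, map_sum, map_sum, map_sum]
  refine Finset.sum_congr rfl fun c _ => ?_
  rw [h.apply_basis c.2, TensorProduct.sum_tmul, map_sum, map_sum]
  simp only [TensorProduct.assoc_tmul, TensorProduct.comm_tmul]
  exact (pathCoeff_sum (k := k) (fun d => matrixCoeff (flipCoaction rho) c d ⊗ₜ[k]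
    matrixCoeff (flipCoaction rho) a c) hb)

open Classical in
lemma IsRightBasePreserving.counit_matrixCoeff (h : IsRightBasePreserving (pathGrading k V) rho)
    {a b : QPath V} (hab : a.length = b.length) :
    counit (R := k) (matrixCoeff (flipCoaction rho) a b) = if a = b then 1 else 0 := by
  have key := congrArg (fun t => (CompAlgebra.basis k _).coord b t)
    (LinearMap.congr_fun h.counit (CompAlgebra.basis k _ a))
  simp only [LinearMap.comp_apply, LinearEquiv.coe_coe, h.apply_basis hab, map_sum,
    LinearMap.lTensor_tmul, TensorProduct.rid_tmul, map_smul, Module.Basis.coord_apply,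
    Module.Basis.repr_self, LinearMap.id_apply] at key
  rw [Finset.sum_eq_single ⟨b, rfl⟩] at key
  · simpa [Finsupp.single_apply] using key
  · intro c _ hc
    rw [Finsupp.single_apply, if_neg fun e => hc (Subtype.ext e), smul_zero]
  · simp

/-- The isomorphism `kQ₀ ≅ H_s` supplies the hypotheses of `UQSGd.vertex_relations` for the opposite
coproduct. -/
lemma IsRightBasePreserving.vertex_relations [Fintype V] [DecidableEq V]
    (h : IsRightBasePreserving (pathGrading k V) rho) :
    (∀ i j i' j' : V, matrixCoeff (flipCoaction rho) (.nil i) (.nil j) *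
        matrixCoeff (flipCoaction rho) (.nil i') (.nil j') =
      if i = i' ∧ j = j' then matrixCoeff (flipCoaction rho) (.nil i) (.nil j) else 0) ∧
      ∑ i : V, ∑ j : V, matrixCoeff (flipCoaction rho) (.nil i) (.nil j) = 1 := by
  obtain ⟨rho₀, hrho₀, φ, hφ, hrange, hcomul⟩ := h.base
  obtain ⟨g, hg⟩ := exists_dual_vertexElt (ψ := φ.toLinearMap) hφ
  simp only [AlgHom.toLinearMap_apply] at hg
  set z := matrixCoeff (flipCoaction rho) with hz
  have hrhoE (i : V) : rho₀ (vertexElt k i) =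
      ∑ j, vertexElt k j ⊗ₜ[k] z (.nil i) (.nil j) := by
    apply Module.Flat.rTensor_preserves_injective_linearMap (M := H) (pathGrading k V 0).subtype
      (Submodule.injective_subtype _)
    refine (LinearMap.congr_fun hrho₀ (vertexElt k i)).symm.trans ?_
    rw [LinearMap.comp_apply, Submodule.subtype_apply, coe_vertexElt, h.apply_basis (n := 0) rfl,
      map_sum]
    refine (QPath.sum_length_zero fun c => CompAlgebra.basis k _ c ⊗ₜ[k]
      z (.nil i) c).trans (Finset.sum_congr rfl fun j _ => ?_)
    rw [LinearMap.rTensor_tmul, Submodule.subtype_apply, coe_vertexElt]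
  have hΔy (i : V) : comul (R := k) (φ (vertexElt k i)) =
      ∑ j, φ (vertexElt k j) ⊗ₜ[k] z (.nil i) (.nil j) := by
    rw [hcomul, hrhoE, map_sum]
    rfl
  have hy₁ : ∑ i, φ (vertexElt k i) = 1 := by rw [← map_sum, sum_vertexElt, map_one]
  obtain ⟨t, ht⟩ : ∃ t : V → H, ∀ j, ∑ i, z (.nil i) (.nil j) = t j := ⟨_, fun _ => rfl⟩
  have hΔ1 : comul (R := k) (1 : H) = ∑ j, φ (vertexElt k j) ⊗ₜ[k] t j := by
    rw [← hy₁, map_sum]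
    simp only [hΔy, ← ht, TensorProduct.tmul_sum]
    exact Finset.sum_comm
  -- The elements `x i` provide functionals dual to the row sums of the vertex matrix.
  have hx (i : V) : ∃ x : H, ∀ j, counit (R := k) (x * t j) = if i = j then 1 else 0 := by
    obtain ⟨x, hx⟩ : φ (vertexElt k i) ∈ sourceCounital k H :=
      hrange ▸ LinearMap.mem_range_self φ.toLinearMap _
    refine ⟨x, fun j => ?_⟩
    have := congrArg (g j) hx
    rw [hg] at this
    rw [← this]
    change _ = g j (TensorProduct.rid k H
      ((counit ∘ₗ LinearMap.mulLeft k x).lTensor H (comul (1 : H))))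
    simp [hΔ1, hg]
  choose x hx using hx
  -- The counital functional acts on the last tensor factor of the iterated coproduct of `1`.
  have hcoassoc : comul.lTensor H (comul (R := k) (1 : H)) =
      ∑ j, TensorProduct.assoc k H H H (comul (φ (vertexElt k j)) ⊗ₜ[k] t j) := by
    rw [← Coalgebra.coassoc_apply, hΔ1, map_sum, map_sum]
    simp
  let L (i : V) : H ⊗[k] (H ⊗[k] H) →ₗ[k] H ⊗[k] H :=
    (TensorProduct.rid k (H ⊗[k] H)).toLinearMap ∘ₗ
      (counit ∘ₗ LinearMap.mulLeft k (x i)).lTensor _ ∘ₗ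
        (TensorProduct.assoc k H H H).symm.toLinearMap
  have hL (i : V) (a b c : H) : L i (a ⊗ₜ (b ⊗ₜ c)) = counit (R := k) (x i * c) • a ⊗ₜ[k] b := by
    simp [L]
  have hLcomul (i : V) : L i (comul.lTensor H (comul (R := k) (1 : H))) =
      comul (φ (vertexElt k i)) := by
    rw [hcoassoc]
    simp [L, hx]
  refine UQSGd.vertex_relations
    ((TensorProduct.comm k H H).toLinearMap ∘ₗ comul (R := k)) counit (fun a b => ?_)
    (fun a => ?_) counit_mul_eq_swap (fun a b => ?_) hg (fun i j => ?_) hy₁ (fun i => ?_)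
    (fun i j => ?_) (fun i j => ?_) (fun i i' j => ?_) (fun i => ?_) (fun i => ?_)
  · change Algebra.TensorProduct.comm k H H (comul (a * b)) =
      Algebra.TensorProduct.comm k H H (comul a) * Algebra.TensorProduct.comm k H H (comul b)
    rw [WeakBialgebra.comul_mul, map_mul]
  · rw [LinearMap.comp_apply, LinearEquiv.coe_coe, LinearMap.lTensor_comm,
      Coalgebra.rTensor_counit_comul]
    simp
  · rw [counit_mul_eq, LinearMap.comp_apply, LinearEquiv.coe_coe, TensorProduct.comm_comm]
  · rw [← map_mul, vertexElt_mul]; split_ifs <;> simp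
  · rw [LinearMap.comp_apply, hΔy, map_sum]
    simp
  · rw [LinearMap.comp_apply, h.comul_matrixCoeff (n := 0) rfl rfl, map_sum]
    exact QPath.sum_length_zero fun c => z (.nil i) c ⊗ₜ[k] z c (.nil j)
  · rw [h.counit_matrixCoeff (a := .nil i) (b := .nil j) rfl]
    classical
    exact if_congr ⟨fun e => congrArg QPath.src e, congrArg _⟩ rfl rfl
  · rw [matrixCoeff_mul h.flip_apply_mem h.flip_map_mul (a := .nil i) (b := .nil j)
      (a' := .nil i') (b' := .nil j) rfl rfl rfl]
    by_cases H : i = i'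
    · subst H
      rw [if_pos rfl, dif_pos (by rfl)]
      exact congrArg₂ z (QPath.nil_comp (QPath.nil i) i rfl)
        (QPath.nil_comp (QPath.nil j) j rfl)
    · rw [if_neg H, dif_neg (by exact H)]
  · have := congrArg (L i) (WeakBialgebra.comul_one_swap (k := k) (H := H))
    rw [hLcomul] at this
    rw [LinearMap.comp_apply, this]
    simp [ht, hΔ1, TensorProduct.sum_tmul, TensorProduct.tmul_sum, Finset.sum_mul_sum, hx, hL]
  · have := congrArg (L i) (WeakBialgebra.comul_one (k := k) (H := H))
    rw [hLcomul] at this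
    rw [LinearMap.comp_apply, this]
    simp [ht, hΔ1, TensorProduct.sum_tmul, TensorProduct.tmul_sum, Finset.sum_mul_sum, hx, hL]

/-- The coefficient of `b` in `rho a` is the image of `x_{b,a}`, hence the transposition. -/
lemma IsRightBasePreserving.isFaceMatrix (h : IsRightBasePreserving (pathGrading k V) rho) :
    IsFaceMatrix k fun a b => matrixCoeff (flipCoaction rho) b a := by
  classical
  have := Fintype.ofFinite V
  refine ⟨fun ha hb => h.comul_matrixCoeff hb ha, fun hab => ?_, fun hab hab' H H' => ?_,
    fun i j i' j' => ?_, ?_⟩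
  · rw [h.counit_matrixCoeff hab.symm]
    exact if_congr eq_comm rfl rfl
  · rw [matrixCoeff_mul h.flip_apply_mem h.flip_map_mul hab.symm hab'.symm H, dif_pos H']
  · rw [h.vertex_relations.1]
    exact if_congr and_comm rfl rfl
  · intro _
    rw [Finset.sum_comm]
    exact h.vertex_relations.2

end Right

end BasePreserving

/-! ### The standard coactions are base preserving -/

namespace FaceAlgebra

section Counital

variable (k : Type*) [Field k] {V : Type*} [Quiver V] [Fintype V]

/-- The sum of the generators `x_{i,j}` over `j`. -/
noncomputable def rowSum (i : V) : FaceAlgebra k V := ∑ j : V, face k (.nil i) (.nil j)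

/-- The sum of the generators `x_{i,j}` over `i`. -/
noncomputable def colSum (j : V) : FaceAlgebra k V := ∑ i : V, face k (.nil i) (.nil j)

lemma sum_rowSum : ∑ i : V, rowSum k i = 1 := (one_eq k).symm

lemma sum_colSum : ∑ j : V, colSum k j = 1 := by
  rw [one_eq, Finset.sum_comm]; rfl

lemma rowSum_mul_rowSum [DecidableEq V] (i j : V) :
    rowSum k i * rowSum k j = if i = j then rowSum k i else 0 := by
  classical
  simp only [rowSum, Finset.sum_mul_sum, (relations k).1]
  split_ifs with h <;> simp [h]

lemma colSum_mul_colSum [DecidableEq V] (i j : V) :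
    colSum k i * colSum k j = if i = j then colSum k i else 0 := by
  classical
  simp only [colSum, Finset.sum_mul_sum, (relations k).1]
  split_ifs with h <;> simp [h]

variable [∀ i j : V, Finite (i ⟶ j)]

lemma comul_colSum (j : V) : comul (R := k) (colSum k j) =
    ∑ m : V, colSum k m ⊗ₜ[k] face k (QPath.nil m) (.nil j) := by
  have h (i j : V) : comul (R := k) (face k (.nil i) (.nil j)) =
      ∑ l : V, face k (QPath.nil i) (.nil l) ⊗ₜ[k] face k (.nil l) (.nil j) := by
    rw [comul_face k (n := 0) rfl rfl]
    exact QPath.sum_length_zero fun c => face k (QPath.nil i) c ⊗ₜ[k] face k c (QPath.nil j)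
  simp only [colSum, map_sum, h, TensorProduct.sum_tmul]
  exact Finset.sum_comm

lemma counit_colSum_mul_rowSum [DecidableEq V] (i j : V) :
    counit (R := k) (colSum k i * rowSum k j) = if i = j then 1 else 0 := by
  classical
  rw [colSum, rowSum, right_mul_left, counit_face]
  exact if_congr ⟨fun e => (congrArg QPath.src e).symm, fun e => congrArg _ e.symm⟩ rfl rfl

variable (V) in
lemma comul_one_eq_sum : comul (R := k) (1 : FaceAlgebra k V) =
    ∑ l : V, colSum k l ⊗ₜ[k] rowSum k l :=
  comul_one_eq k V

lemma sourceMap_eq (x : FaceAlgebra k V) : sourceMap k (FaceAlgebra k V) x =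
    ∑ l : V, counit (R := k) (x * rowSum k l) • colSum k l := by
  change TensorProduct.rid k _ ((counit ∘ₗ LinearMap.mulLeft k x).lTensor _
    (comul (1 : FaceAlgebra k V))) = _
  rw [comul_one_eq_sum]
  simp

lemma targetMap_eq (x : FaceAlgebra k V) : targetMap k (FaceAlgebra k V) x =
    ∑ l : V, counit (R := k) (colSum k l * x) • rowSum k l := by
  change TensorProduct.lid k _ ((counit ∘ₗ LinearMap.mulRight k x).rTensor _
    (comul (1 : FaceAlgebra k V))) = _
  rw [comul_one_eq_sum]
  simp

variable (V) in
lemma sourceCounital_eq_span :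
    sourceCounital k (FaceAlgebra k V) = Submodule.span k (Set.range (colSum k (V := V))) := by
  classical
  refine le_antisymm ?_ (Submodule.span_le.2 ?_)
  · rintro _ ⟨x, rfl⟩
    rw [sourceMap_eq]
    exact Submodule.sum_mem _ fun l _ => Submodule.smul_mem _ _ (Submodule.subset_span ⟨l, rfl⟩)
  · rintro _ ⟨j, rfl⟩
    refine ⟨colSum k j, ?_⟩
    simp [sourceMap_eq, counit_colSum_mul_rowSum]

variable (V) in
lemma targetCounital_eq_span :
    targetCounital k (FaceAlgebra k V) = Submodule.span k (Set.range (rowSum k (V := V))) := by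
  classical
  refine le_antisymm ?_ (Submodule.span_le.2 ?_)
  · rintro _ ⟨x, rfl⟩
    rw [targetMap_eq]
    exact Submodule.sum_mem _ fun l _ => Submodule.smul_mem _ _ (Submodule.subset_span ⟨l, rfl⟩)
  · rintro _ ⟨j, rfl⟩
    refine ⟨rowSum k j, ?_⟩
    simp [targetMap_eq, counit_colSum_mul_rowSum]

variable (V) in
lemma linearIndependent_rowSum : LinearIndependent k (rowSum k (V := V)) := by
  classical
  refine Fintype.linearIndependent_iff.2 fun c hc i => ?_
  have := congrArg (fun t => counit (R := k) (colSum k i * t)) hc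
  simpa [Finset.mul_sum, counit_colSum_mul_rowSum] using this

variable (V) in
lemma linearIndependent_colSum : LinearIndependent k (colSum k (V := V)) := by
  classical
  refine Fintype.linearIndependent_iff.2 fun c hc i => ?_
  have := congrArg (fun t => counit (R := k) (t * rowSum k i)) hc
  simpa [Finset.sum_mul, counit_colSum_mul_rowSum] using this

end Counital

end FaceAlgebra

section DegreeZero

variable {k V : Type*} [Field k] [Quiver V]

lemma pathBasis_zero (a : {a : QPath V // a.length = 0}) :
    pathBasis k V 0 a = vertexElt k a.1.src := by
  obtain ⟨a, ha⟩ := a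
  exact congrArg (pathBasis k V 0) (Subtype.ext (QPath.eq_nil_of_length a ha))

lemma hom_ext_vertexElt {M : Type*} [AddCommGroup M] [Module k M]
    {f g : pathGrading k V 0 →ₗ[k] M} (h : ∀ i, f (vertexElt k i) = g (vertexElt k i)) : f = g :=
  (pathBasis k V 0).ext fun a => by rw [pathBasis_zero, h]

lemma vertexElt_induction {p : pathGrading k V 0 → Prop} (x : pathGrading k V 0)
    (vertex : ∀ i, p (vertexElt k i)) (zero : p 0) (add : ∀ x y, p x → p y → p (x + y))
    (smul : ∀ (c : k) x, p x → p (c • x)) : p x := by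
  have hx : x ∈ Submodule.span k (Set.range (pathBasis k V 0)) := by
    rw [Module.Basis.span_eq]; trivial
  induction hx using Submodule.span_induction with
  | mem y hy => obtain ⟨a, rfl⟩ := hy; exact pathBasis_zero (k := k) a ▸ vertex _
  | zero => exact zero
  | add y z _ _ hy hz => exact add y z hy hz
  | smul c y _ hy => exact smul c y hy

/-- Linearly independent orthogonal idempotents with sum one, indexed by the vertices, embed the
degree zero part of the path algebra. -/
lemma exists_vertexAlgHom {H : Type*} [Ring H] [Algebra k H] [Fintype V] [DecidableEq V]
    {w : V → H} (hli : LinearIndependent k w)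
    (hw : ∀ i j, w i * w j = if i = j then w i else 0) (hw₁ : ∑ i, w i = 1) :
    ∃ ψ : pathGrading k V 0 →ₐ[k] H, (∀ i, ψ (vertexElt k i) = w i) ∧ Function.Injective ψ ∧
      LinearMap.range ψ.toLinearMap = Submodule.span k (Set.range w) := by
  let F : pathGrading k V 0 →ₗ[k] H := (pathBasis k V 0).constr k fun a => w a.1.src
  have hF (i : V) : F (vertexElt k i) = w i := Module.Basis.constr_basis ..
  have hmul (x y : pathGrading k V 0) : F (x * y) = F x * F y := by
    induction x using vertexElt_induction with
    | zero => rw [zero_mul, map_zero, zero_mul]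
    | add x₁ x₂ h₁ h₂ => rw [add_mul, map_add, map_add, h₁, h₂, add_mul]
    | smul c x h =>
      rw [show c • x * y = c • (x * y) from Subtype.ext (smul_mul_assoc c (x : PathAlgebra k V) y),
        map_smul, map_smul, h, smul_mul_assoc]
    | vertex i =>
    induction y using vertexElt_induction with
    | zero => rw [mul_zero, map_zero, mul_zero]
    | add x₁ x₂ h₁ h₂ => rw [mul_add, map_add, map_add, h₁, h₂, mul_add]
    | smul c x h =>
      rw [show vertexElt k i * c • x = c • (vertexElt k i * x) from
        Subtype.ext (mul_smul_comm c (vertexElt k i : PathAlgebra k V) x),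
        map_smul, map_smul, h, mul_smul_comm]
    | vertex j =>
    rw [vertexElt_mul, hF, hF, hw]
    split_ifs
    · rw [hF]
    · rw [map_zero]
  have hone : F 1 = 1 := by rw [← sum_vertexElt, map_sum, ← hw₁]; simp only [hF]
  refine ⟨AlgHom.ofLinearMap F hone hmul, hF, ?_, ?_⟩
  · refine (pathBasis k V 0).injective_constr_of_linearIndependent (R₂ := k) (hli.comp _ ?_)
    rintro ⟨a, ha⟩ ⟨b, hb⟩ h
    exact Subtype.ext ((QPath.eq_nil_of_length a ha).trans
      ((congrArg QPath.nil h).trans (QPath.eq_nil_of_length b hb).symm))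
  · change LinearMap.range F = _
    rw [Module.Basis.constr_range]
    congr 1
    ext x
    constructor
    · rintro ⟨a, rfl⟩; exact ⟨_, rfl⟩
    · rintro ⟨i, rfl⟩; exact ⟨⟨.nil i, rfl⟩, rfl⟩

end DegreeZero

namespace FaceAlgebra

section Coactions

variable (k : Type*) [Field k] {V : Type*} [Quiver V] [Finite V] [∀ i j : V, Finite (i ⟶ j)]

variable {k} in
/-- The comodule axioms at `v a`, for a family `v` indexed by the paths of length `n` on which `F` is
given by the matrix `x_{a,b}`. It applies both to `kQ` and to its graded components. -/
lemma left_comodule_apply {N : Type*} [AddCommGroup N] [Module k N] {n : ℕ}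
    {v : {a : QPath V // a.length = n} → N} {F : N →ₗ[k] FaceAlgebra k V ⊗[k] N}
    (hF : ∀ a, F (v a) = ∑ b, face k a.1 b.1 ⊗ₜ[k] v b) (a : {a : QPath V // a.length = n}) :
    TensorProduct.assoc k _ _ _ (comul.rTensor N (F (v a))) = F.lTensor _ (F (v a)) ∧
      TensorProduct.lid k N (counit.rTensor N (F (v a))) = v a := by
  classical
  constructor
  · simp only [hF, map_sum, LinearMap.rTensor_tmul, LinearMap.lTensor_tmul,
      fun b : {b : QPath V // b.length = n} => comul_face k a.2 b.2, TensorProduct.sum_tmul,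
      TensorProduct.tmul_sum, TensorProduct.assoc_tmul]
    exact Finset.sum_comm
  · simp only [hF, map_sum, LinearMap.rTensor_tmul, counit_face, TensorProduct.lid_tmul,
      ← Subtype.ext_iff, ite_smul, one_smul, zero_smul, Finset.sum_ite_eq, Finset.mem_univ, if_true]

variable {k} in
lemma right_comodule_apply {N : Type*} [AddCommGroup N] [Module k N] {n : ℕ}
    {v : {a : QPath V // a.length = n} → N} {F : N →ₗ[k] N ⊗[k] FaceAlgebra k V}
    (hF : ∀ a, F (v a) = ∑ b, v b ⊗ₜ[k] face k b.1 a.1) (a : {a : QPath V // a.length = n}) :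
    TensorProduct.assoc k _ _ _ (F.rTensor _ (F (v a))) = comul.lTensor N (F (v a)) ∧
      TensorProduct.rid k N (counit.lTensor N (F (v a))) = v a := by
  classical
  constructor
  · simp only [hF, map_sum, LinearMap.rTensor_tmul, LinearMap.lTensor_tmul,
      fun b : {b : QPath V // b.length = n} => comul_face k b.2 a.2, TensorProduct.sum_tmul,
      TensorProduct.tmul_sum, TensorProduct.assoc_tmul]
    exact Finset.sum_comm
  · simp only [hF, map_sum, LinearMap.lTensor_tmul, counit_face, TensorProduct.rid_tmul,
      ← Subtype.ext_iff, ite_smul, one_smul, zero_smul, Finset.sum_ite_eq', Finset.mem_univ,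
      if_true]

lemma leftCoaction_basis {n : ℕ} {a : QPath V} (ha : a.length = n) :
    leftCoaction k V (CompAlgebra.basis k _ a) = ∑ b : {b : QPath V // b.length = n},
      face k a b ⊗ₜ[k] CompAlgebra.basis k _ b.1 := by
  subst ha
  rw [leftCoaction, Module.Basis.constr_basis]

lemma rightCoaction_basis {n : ℕ} {a : QPath V} (ha : a.length = n) :
    rightCoaction k V (CompAlgebra.basis k _ a) = ∑ b : {b : QPath V // b.length = n},
      CompAlgebra.basis k _ b.1 ⊗ₜ[k] face k b a := by
  subst ha
  rw [rightCoaction, Module.Basis.constr_basis]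

lemma leftCoaction_mul (x y : PathAlgebra k V) :
    leftCoaction k V (x * y) = leftCoaction k V x * leftCoaction k V y := by
  induction x using CompAlgebra.induction_on with
  | zero => simp
  | add x₁ x₂ h₁ h₂ => simp [add_mul, h₁, h₂]
  | smul c x h => rw [smul_mul_assoc, map_smul, map_smul, h, smul_mul_assoc]
  | basis a =>
  induction y using CompAlgebra.induction_on with
  | zero => simp
  | add x₁ x₂ h₁ h₂ => simp [mul_add, h₁, h₂]
  | smul c x h => rw [mul_smul_comm, map_smul, map_smul, h, mul_smul_comm]
  | basis a' =>
  have hface (c : {c : QPath V // c.length = a.length})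
      (c' : {c : QPath V // c.length = a'.length}) :=
    face_mul k (a := a) (a' := a') c.2.symm c'.2.symm
  rw [leftCoaction_basis k (a := a) rfl, leftCoaction_basis k (a := a') rfl, Finset.sum_mul_sum,
    basis_mul_basis_path]
  simp only [Algebra.TensorProduct.tmul_mul_tmul, hface, basis_mul_basis_path]
  by_cases H : a.tgt = a'.src
  · rw [dif_pos H, leftCoaction_basis k (n := a.length + a'.length) (by simp),
      QPath.sum_comp a.length a'.length
        (fun c => face k (a.comp a' H) c ⊗ₜ[k] CompAlgebra.basis k _ c)]
    refine Finset.sum_congr rfl fun c _ => Finset.sum_congr rfl fun c' _ => ?_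
    by_cases hc : c.1.tgt = c'.1.src
    · rw [dif_pos hc, dif_pos hc, dif_pos ⟨H, hc⟩]
    · rw [dif_neg hc, dif_neg hc, TensorProduct.tmul_zero]
  · rw [dif_neg H, map_zero]
    symm
    refine Finset.sum_eq_zero fun c _ => Finset.sum_eq_zero fun c' _ => ?_
    rw [dif_neg fun e => H e.1, TensorProduct.zero_tmul]

lemma rightCoaction_mul (x y : PathAlgebra k V) :
    rightCoaction k V (x * y) = rightCoaction k V x * rightCoaction k V y := by
  induction x using CompAlgebra.induction_on with
  | zero => simp
  | add x₁ x₂ h₁ h₂ => simp [add_mul, h₁, h₂]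
  | smul c x h => rw [smul_mul_assoc, map_smul, map_smul, h, smul_mul_assoc]
  | basis a =>
  induction y using CompAlgebra.induction_on with
  | zero => simp
  | add x₁ x₂ h₁ h₂ => simp [mul_add, h₁, h₂]
  | smul c x h => rw [mul_smul_comm, map_smul, map_smul, h, mul_smul_comm]
  | basis a' =>
  have hface (c : {c : QPath V // c.length = a.length})
      (c' : {c : QPath V // c.length = a'.length}) :=
    face_mul k (b := a) (b' := a') c.2 c'.2
  rw [rightCoaction_basis k (a := a) rfl, rightCoaction_basis k (a := a') rfl, Finset.sum_mul_sum,
    basis_mul_basis_path]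
  simp only [Algebra.TensorProduct.tmul_mul_tmul, hface, basis_mul_basis_path]
  by_cases H : a.tgt = a'.src
  · rw [dif_pos H, rightCoaction_basis k (n := a.length + a'.length) (by simp),
      QPath.sum_comp a.length a'.length
        (fun c => CompAlgebra.basis k _ c ⊗ₜ[k] face k c (a.comp a' H))]
    refine Finset.sum_congr rfl fun c _ => Finset.sum_congr rfl fun c' _ => ?_
    by_cases hc : c.1.tgt = c'.1.src
    · rw [dif_pos hc, dif_pos hc, dif_pos ⟨hc, H⟩]
    · rw [dif_neg hc, dif_neg hc, TensorProduct.zero_tmul]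
  · rw [dif_neg H, map_zero]
    symm
    refine Finset.sum_eq_zero fun c _ => Finset.sum_eq_zero fun c' _ => ?_
    rw [dif_neg (c := c.1.tgt = c'.1.src ∧ a.tgt = a'.src) fun e => H e.2,
      TensorProduct.tmul_zero]

lemma leftCoaction_nil [Fintype V] (i : V) :
    leftCoaction k V (CompAlgebra.basis k _ (.nil i)) =
      ∑ j : V, face k (.nil i) (.nil j) ⊗ₜ[k] CompAlgebra.basis k _ (QPath.nil j) :=
  (leftCoaction_basis k (n := 0) rfl).trans <| QPath.sum_length_zero fun c =>
    face k (.nil i) c ⊗ₜ[k] CompAlgebra.basis k _ c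

lemma rightCoaction_nil [Fintype V] (i : V) :
    rightCoaction k V (CompAlgebra.basis k _ (.nil i)) =
      ∑ j : V, CompAlgebra.basis k _ (QPath.nil j) ⊗ₜ[k] face k (.nil j) (.nil i) :=
  (rightCoaction_basis k (n := 0) rfl).trans <| QPath.sum_length_zero fun c =>
    CompAlgebra.basis k _ c ⊗ₜ[k] face k c (.nil i)

variable (V) in
/-- The restriction of the standard left coaction to the paths of length `n`. -/
noncomputable def gradedLeftCoaction (n : ℕ) :
    pathGrading k V n →ₗ[k] FaceAlgebra k V ⊗[k] pathGrading k V n :=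
  (pathBasis k V n).constr k fun a => ∑ b, face k a.1 b.1 ⊗ₜ[k] pathBasis k V n b

variable (V) in
/-- The restriction of the standard right coaction to the paths of length `n`. -/
noncomputable def gradedRightCoaction (n : ℕ) :
    pathGrading k V n →ₗ[k] pathGrading k V n ⊗[k] FaceAlgebra k V :=
  (pathBasis k V n).constr k fun a => ∑ b, pathBasis k V n b ⊗ₜ[k] face k b.1 a.1

lemma gradedLeftCoaction_basis {n : ℕ} (a : {a : QPath V // a.length = n}) :
    gradedLeftCoaction k V n (pathBasis k V n a) =
      ∑ b, face k a.1 b.1 ⊗ₜ[k] pathBasis k V n b :=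
  Module.Basis.constr_basis ..

lemma gradedRightCoaction_basis {n : ℕ} (a : {a : QPath V // a.length = n}) :
    gradedRightCoaction k V n (pathBasis k V n a) =
      ∑ b, pathBasis k V n b ⊗ₜ[k] face k b.1 a.1 :=
  Module.Basis.constr_basis ..

lemma leftRestricts_graded (n : ℕ) :
    LeftRestricts (leftCoaction k V) (pathGrading k V n) (gradedLeftCoaction k V n) :=
  (pathBasis k V n).ext fun a => by
    rw [LinearMap.comp_apply, LinearMap.comp_apply, Submodule.subtype_apply, coe_pathBasis,
      gradedLeftCoaction_basis, leftCoaction_basis k a.2, map_sum]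
    simp

lemma rightRestricts_graded (n : ℕ) :
    RightRestricts (rightCoaction k V) (pathGrading k V n) (gradedRightCoaction k V n) :=
  (pathBasis k V n).ext fun a => by
    rw [LinearMap.comp_apply, LinearMap.comp_apply, Submodule.subtype_apply, coe_pathBasis,
      gradedRightCoaction_basis, rightCoaction_basis k a.2, map_sum]
    simp

lemma isLeftComodule_graded (n : ℕ) : IsLeftComodule (gradedLeftCoaction k V n) where
  coassoc := (pathBasis k V n).ext fun a => (left_comodule_apply (gradedLeftCoaction_basis k) a).1
  counit := (pathBasis k V n).ext fun a => (left_comodule_apply (gradedLeftCoaction_basis k) a).2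

lemma isRightComodule_graded (n : ℕ) : IsRightComodule (gradedRightCoaction k V n) where
  coassoc := (pathBasis k V n).ext fun a =>
    (right_comodule_apply (gradedRightCoaction_basis k) a).1
  counit := (pathBasis k V n).ext fun a =>
    (right_comodule_apply (gradedRightCoaction_basis k) a).2

variable (V)

theorem isLeftBasePreserving_leftCoaction :
    IsLeftBasePreserving (pathGrading k V) (leftCoaction k V) where
  coassoc := (CompAlgebra.basis k _).ext fun a => (left_comodule_apply (n := a.length)
    (v := fun b => CompAlgebra.basis k _ b.1) (fun b => leftCoaction_basis k b.2) ⟨a, rfl⟩).1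
  counit := (CompAlgebra.basis k _).ext fun a => (left_comodule_apply (n := a.length)
    (v := fun b => CompAlgebra.basis k _ b.1) (fun b => leftCoaction_basis k b.2) ⟨a, rfl⟩).2
  map_mul := leftCoaction_mul k
  map_one_mem := by
    have := Fintype.ofFinite V
    have h : leftCoaction k V 1 =
        ∑ j : V, colSum k j ⊗ₜ[k] CompAlgebra.basis k _ (QPath.nil j) := by
      rw [pathAlgebra_one_eq, map_sum]
      simp only [leftCoaction_nil, colSum, TensorProduct.sum_tmul]
      exact Finset.sum_comm
    rw [h]
    refine Submodule.sum_mem _ fun j _ => ?_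
    have hj : colSum k j ∈ sourceCounital k (FaceAlgebra k V) :=
      sourceCounital_eq_span k V ▸ Submodule.subset_span ⟨j, rfl⟩
    exact ⟨⟨_, hj⟩ ⊗ₜ CompAlgebra.basis k _ (.nil j), rfl⟩
  linear n := ⟨_, leftRestricts_graded k n, isLeftComodule_graded k n⟩
  base := by
    classical
    have := Fintype.ofFinite V
    obtain ⟨ψ, hψ, hinj, hrange⟩ := exists_vertexAlgHom (linearIndependent_rowSum k V)
      (rowSum_mul_rowSum k) (sum_rowSum k)
    refine ⟨_, leftRestricts_graded k 0, ψ, hinj, hrange.trans (targetCounital_eq_span k V).symm,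
      LinearMap.congr_fun (f := comul ∘ₗ ψ.toLinearMap)
        (g := ψ.toLinearMap.lTensor _ ∘ₗ gradedLeftCoaction k V 0)
        (hom_ext_vertexElt fun i => ?_)⟩
    rw [LinearMap.comp_apply, LinearMap.comp_apply, AlgHom.toLinearMap_apply, hψ, rowSum,
      comul_left, vertexElt, gradedLeftCoaction_basis, map_sum]
    simp only [LinearMap.lTensor_tmul, pathBasis_zero, AlgHom.toLinearMap_apply, hψ]
    exact (QPath.sum_length_zero fun c =>
      face k (QPath.nil i) c ⊗ₜ[k] rowSum k c.src).symm

theorem isRightBasePreserving_rightCoaction :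
    IsRightBasePreserving (pathGrading k V) (rightCoaction k V) where
  coassoc := (CompAlgebra.basis k _).ext fun a => (right_comodule_apply (n := a.length)
    (v := fun b => CompAlgebra.basis k _ b.1) (fun b => rightCoaction_basis k b.2) ⟨a, rfl⟩).1
  counit := (CompAlgebra.basis k _).ext fun a => (right_comodule_apply (n := a.length)
    (v := fun b => CompAlgebra.basis k _ b.1) (fun b => rightCoaction_basis k b.2) ⟨a, rfl⟩).2
  map_mul := rightCoaction_mul k
  map_one_mem := by
    have := Fintype.ofFinite V
    have h : rightCoaction k V 1 =
        ∑ j : V, CompAlgebra.basis k _ (QPath.nil j) ⊗ₜ[k] rowSum k j := by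
      rw [pathAlgebra_one_eq, map_sum]
      simp only [rightCoaction_nil, rowSum, TensorProduct.tmul_sum]
      exact Finset.sum_comm
    rw [h]
    refine Submodule.sum_mem _ fun j _ => ?_
    have hj : rowSum k j ∈ targetCounital k (FaceAlgebra k V) :=
      targetCounital_eq_span k V ▸ Submodule.subset_span ⟨j, rfl⟩
    exact ⟨CompAlgebra.basis k _ (.nil j) ⊗ₜ ⟨_, hj⟩, rfl⟩
  linear n := ⟨_, rightRestricts_graded k n, isRightComodule_graded k n⟩
  base := by
    classical
    have := Fintype.ofFinite V
    obtain ⟨φ, hφ, hinj, hrange⟩ := exists_vertexAlgHom (linearIndependent_colSum k V)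
      (colSum_mul_colSum k) (sum_colSum k)
    refine ⟨_, rightRestricts_graded k 0, φ, hinj, hrange.trans (sourceCounital_eq_span k V).symm,
      LinearMap.congr_fun (f := comul ∘ₗ φ.toLinearMap)
        (g := φ.toLinearMap.rTensor _ ∘ₗ gradedRightCoaction k V 0)
        (hom_ext_vertexElt fun i => ?_)⟩
    rw [LinearMap.comp_apply, LinearMap.comp_apply, AlgHom.toLinearMap_apply, hφ,
      comul_colSum, vertexElt, gradedRightCoaction_basis, map_sum]
    simp only [LinearMap.rTensor_tmul, pathBasis_zero, AlgHom.toLinearMap_apply, hφ]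
    exact (QPath.sum_length_zero fun c =>
      colSum k c.src ⊗ₜ[k] face k c (QPath.nil i)).symm

theorem isTransposed_coactions :
    IsTransposed (pathBasis k V) (leftCoaction k V) (rightCoaction k V) := fun n =>
  ⟨fun a b => face k a.1 b.1, fun a => by
    simp only [coe_pathBasis]
    exact ⟨leftCoaction_basis k a.2, rightCoaction_basis k a.2⟩⟩

end Coactions

end FaceAlgebra

/-! ### The universal property -/

namespace FaceAlgebra

section Universal

variable {k V H : Type*} [Field k] [Quiver V] [Finite V] [∀ i j : V, Finite (i ⟶ j)] [Ring H]
  [WeakBialgebra k H]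

lemma rTensor_comp_leftCoaction_eq_iff {lam : PathAlgebra k V →ₗ[k] H ⊗[k] PathAlgebra k V}
    (h : IsLeftBasePreserving (pathGrading k V) lam) (π : FaceAlgebra k V →ₐc[k] H) :
    (π : FaceAlgebra k V →ₗ[k] H).rTensor (PathAlgebra k V) ∘ₗ leftCoaction k V = lam ↔
      ∀ a b : QPath V, a.length = b.length → π (face k a b) = matrixCoeff lam a b := by
  have hbasis (a : QPath V) : (π : FaceAlgebra k V →ₗ[k] H).rTensor (PathAlgebra k V)
      (leftCoaction k V (CompAlgebra.basis k _ a)) =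
        ∑ b : {b : QPath V // b.length = a.length}, π (face k a b) ⊗ₜ[k]
          CompAlgebra.basis k _ b.1 := by
    rw [leftCoaction_basis k rfl, map_sum]
    rfl
  constructor
  · rintro rfl a b hab
    rw [matrixCoeff, LinearMap.comp_apply, hbasis]
    exact (pathCoeff_sum (k := k) (fun b => π (face k a b)) hab.symm).symm
  · intro hπ
    refine (CompAlgebra.basis k _).ext fun a => (hbasis a).trans ?_
    rw [h.apply_basis rfl]
    exact Finset.sum_congr rfl fun b _ => by rw [hπ a b b.2.symm]

lemma lTensor_comp_rightCoaction_eq_iff {rho : PathAlgebra k V →ₗ[k] PathAlgebra k V ⊗[k] H}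
    (h : IsRightBasePreserving (pathGrading k V) rho) (π : FaceAlgebra k V →ₐc[k] H) :
    (π : FaceAlgebra k V →ₗ[k] H).lTensor (PathAlgebra k V) ∘ₗ rightCoaction k V = rho ↔
      ∀ a b : QPath V, a.length = b.length →
        π (face k a b) = matrixCoeff (flipCoaction rho) b a := by
  have hbasis (a : QPath V) : (π : FaceAlgebra k V →ₗ[k] H).lTensor (PathAlgebra k V)
      (rightCoaction k V (CompAlgebra.basis k _ a)) =
        ∑ b : {b : QPath V // b.length = a.length}, CompAlgebra.basis k _ b.1 ⊗ₜ[k]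
          π (face k b a) := by
    rw [rightCoaction_basis k rfl, map_sum]
    rfl
  constructor
  · rintro rfl a b hab
    rw [matrixCoeff, flipCoaction, LinearMap.comp_apply, LinearMap.comp_apply, hbasis,
      LinearEquiv.coe_coe, map_sum]
    exact (pathCoeff_sum (k := k) (fun a => π (face k a b)) hab).symm
  · intro hπ
    refine (CompAlgebra.basis k _).ext fun a => (hbasis a).trans ?_
    rw [h.apply_basis rfl]
    exact Finset.sum_congr rfl fun b _ => by rw [hπ b a b.2]

theorem existsUnique_left {lam : PathAlgebra k V →ₗ[k] H ⊗[k] PathAlgebra k V}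
    (h : IsLeftBasePreserving (pathGrading k V) lam) :
    ∃! π : FaceAlgebra k V →ₐc[k] H,
      (π : FaceAlgebra k V →ₗ[k] H).rTensor (PathAlgebra k V) ∘ₗ leftCoaction k V = lam := by
  simp only [rTensor_comp_leftCoaction_eq_iff h]
  obtain ⟨f, hf⟩ := h.isFaceMatrix.exists_bialgHom
  exact ⟨f, hf, fun g hg => bialgHom_ext_face fun a b hab => (hg a b hab).trans (hf a b hab).symm⟩

theorem existsUnique_right {rho : PathAlgebra k V →ₗ[k] PathAlgebra k V ⊗[k] H}
    (h : IsRightBasePreserving (pathGrading k V) rho) :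
    ∃! π : FaceAlgebra k V →ₐc[k] H,
      (π : FaceAlgebra k V →ₗ[k] H).lTensor (PathAlgebra k V) ∘ₗ rightCoaction k V = rho := by
  simp only [lTensor_comp_rightCoaction_eq_iff h]
  obtain ⟨f, hf⟩ := h.isFaceMatrix.exists_bialgHom
  exact ⟨f, hf, fun g hg => bialgHom_ext_face fun a b hab => (hg a b hab).trans (hf a b hab).symm⟩

lemma matrixCoeff_eq_of_isTransposed {lam : PathAlgebra k V →ₗ[k] H ⊗[k] PathAlgebra k V}
    {rho : PathAlgebra k V →ₗ[k] PathAlgebra k V ⊗[k] H}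
    (h : IsTransposed (pathBasis k V) lam rho) {a b : QPath V} (hab : a.length = b.length) :
    matrixCoeff lam a b = matrixCoeff (flipCoaction rho) b a := by
  classical
  obtain ⟨z, hz⟩ := h a.length
  have hl := (hz ⟨a, rfl⟩).1
  have hr := (hz ⟨b, hab.symm⟩).2
  simp only [coe_pathBasis] at hl hr
  rw [matrixCoeff, matrixCoeff, flipCoaction, LinearMap.comp_apply, hl, hr, LinearEquiv.coe_coe,
    map_sum, map_sum, map_sum]
  simp only [TensorProduct.comm_tmul, pathCoeff_tmul_basis]
  rw [Finset.sum_eq_single ⟨b, hab.symm⟩, Finset.sum_eq_single ⟨a, rfl⟩]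
  · simp
  · exact fun c _ hc => if_neg fun e => hc (Subtype.ext e)
  · simp
  · exact fun c _ hc => if_neg fun e => hc (Subtype.ext e)
  · simp

/-- The left universal map also respects the right coaction, since the transposed coactions have the
same matrix. -/
theorem existsUnique_transposed {lam : PathAlgebra k V →ₗ[k] H ⊗[k] PathAlgebra k V}
    {rho : PathAlgebra k V →ₗ[k] PathAlgebra k V ⊗[k] H}
    (hl : IsLeftBasePreserving (pathGrading k V) lam)
    (hr : IsRightBasePreserving (pathGrading k V) rho)
    (h : IsTransposed (pathBasis k V) lam rho) :
    ∃! π : FaceAlgebra k V →ₐc[k] H,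
      (π : FaceAlgebra k V →ₗ[k] H).rTensor (PathAlgebra k V) ∘ₗ leftCoaction k V = lam ∧
      (π : FaceAlgebra k V →ₗ[k] H).lTensor (PathAlgebra k V) ∘ₗ rightCoaction k V = rho := by
  obtain ⟨f, hf, huniq⟩ := existsUnique_left hl
  refine ⟨f, ⟨hf, (lTensor_comp_rightCoaction_eq_iff hr f).2 fun a b hab => ?_⟩,
    fun g hg => huniq g hg.1⟩
  rw [(rTensor_comp_leftCoaction_eq_iff hl f).1 hf a b hab, matrixCoeff_eq_of_isTransposed h hab]

universe w u v e

variable (k : Type u) [Field k] (V : Type v) [Quiver.{e} V] [Finite V]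
  [∀ i j : V, Finite (i ⟶ j)]

theorem isLeftUQSGd :
    IsLeftUQSGd.{w} (pathGrading k V) (FaceAlgebra k V) (leftCoaction k V) :=
  ⟨isLeftBasePreserving_leftCoaction k V, fun _ _ _ _ h => existsUnique_left h⟩

theorem isRightUQSGd :
    IsRightUQSGd.{w} (pathGrading k V) (FaceAlgebra k V) (rightCoaction k V) :=
  ⟨isRightBasePreserving_rightCoaction k V, fun _ _ _ _ h => existsUnique_right h⟩

theorem isTransUQSGd :
    IsTransUQSGd.{w} (pathBasis k V) (FaceAlgebra k V) (leftCoaction k V) (rightCoaction k V) :=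
  ⟨isLeftBasePreserving_leftCoaction k V, isRightBasePreserving_rightCoaction k V,
    isTransposed_coactions k V, fun _ _ _ _ _ hl hr h => existsUnique_transposed hl hr h⟩

end Universal

end FaceAlgebra

/-! ### Uniqueness of universal objects -/

section Unique

lemma exists_bialgEquiv {k O P : Type*} [Field k] [Ring O] [WeakBialgebra k O] [Ring P]
    [WeakBialgebra k P] {f : O →ₐc[k] P} {g : P →ₐc[k] O}
    (hgf : g.comp f = .id k O) (hfg : f.comp g = .id k P) :
    ∃ F : O ≃ₐc[k] P, (F : O →ₗ[k] P) = (f : O →ₗ[k] P) :=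
  ⟨BialgEquiv.ofBialgHom f g hfg hgf, rfl⟩

universe w u v e

variable {k : Type u} {A : Type v} [Field k] [Ring A] [Algebra k A] {𝒜 : ℕ → Submodule k A}
  [GradedAlgebra 𝒜] {O P : Type w} [Ring O] [WeakBialgebra k O] [Ring P] [WeakBialgebra k P]

lemma rTensor_bialgHom_comp {Q : Type*} [Ring Q] [WeakBialgebra k Q] {lamO : A →ₗ[k] O ⊗[k] A}
    {lamP : A →ₗ[k] P ⊗[k] A} {lamQ : A →ₗ[k] Q ⊗[k] A} {f : O →ₐc[k] P} {g : P →ₐc[k] Q}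
    (hf : (f : O →ₗ[k] P).rTensor A ∘ₗ lamO = lamP)
    (hg : (g : P →ₗ[k] Q).rTensor A ∘ₗ lamP = lamQ) :
    ((g.comp f : O →ₐc[k] Q) : O →ₗ[k] Q).rTensor A ∘ₗ lamO = lamQ := by
  rw [← hg, ← hf, ← LinearMap.comp_assoc, ← LinearMap.rTensor_comp]
  rfl

lemma lTensor_bialgHom_comp {Q : Type*} [Ring Q] [WeakBialgebra k Q] {rhoO : A →ₗ[k] A ⊗[k] O}
    {rhoP : A →ₗ[k] A ⊗[k] P} {rhoQ : A →ₗ[k] A ⊗[k] Q} {f : O →ₐc[k] P} {g : P →ₐc[k] Q}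
    (hf : (f : O →ₗ[k] P).lTensor A ∘ₗ rhoO = rhoP)
    (hg : (g : P →ₗ[k] Q).lTensor A ∘ₗ rhoP = rhoQ) :
    ((g.comp f : O →ₐc[k] Q) : O →ₗ[k] Q).lTensor A ∘ₗ rhoO = rhoQ := by
  rw [← hg, ← hf, ← LinearMap.comp_assoc, ← LinearMap.lTensor_comp]
  rfl

lemma rTensor_bialgHom_id (lam : A →ₗ[k] O ⊗[k] A) :
    ((BialgHom.id k O : O →ₐc[k] O) : O →ₗ[k] O).rTensor A ∘ₗ lam = lam := by
  rw [show ((BialgHom.id k O : O →ₐc[k] O) : O →ₗ[k] O) = LinearMap.id from rfl,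
    LinearMap.rTensor_id, LinearMap.id_comp]

lemma lTensor_bialgHom_id (rho : A →ₗ[k] A ⊗[k] O) :
    ((BialgHom.id k O : O →ₐc[k] O) : O →ₗ[k] O).lTensor A ∘ₗ rho = rho := by
  rw [show ((BialgHom.id k O : O →ₐc[k] O) : O →ₗ[k] O) = LinearMap.id from rfl,
    LinearMap.lTensor_id, LinearMap.id_comp]

theorem IsLeftUQSGd.exists_bialgEquiv {lamO : A →ₗ[k] O ⊗[k] A} {lamP : A →ₗ[k] P ⊗[k] A}
    (hO : IsLeftUQSGd.{w} 𝒜 O lamO) (hP : IsLeftUQSGd.{w} 𝒜 P lamP) :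
    ∃ F : O ≃ₐc[k] P, (F : O →ₗ[k] P).rTensor A ∘ₗ lamO = lamP := by
  obtain ⟨f, hf, -⟩ := hO.universal P lamP hP.coacts
  obtain ⟨g, hg, -⟩ := hP.universal O lamO hO.coacts
  obtain ⟨F, hF⟩ := UQSGd.exists_bialgEquiv
    ((hO.universal O lamO hO.coacts).unique (rTensor_bialgHom_comp hf hg) (rTensor_bialgHom_id _))
    ((hP.universal P lamP hP.coacts).unique (rTensor_bialgHom_comp hg hf) (rTensor_bialgHom_id _))
  exact ⟨F, by rw [hF, hf]⟩

theorem IsRightUQSGd.exists_bialgEquiv {rhoO : A →ₗ[k] A ⊗[k] O} {rhoP : A →ₗ[k] A ⊗[k] P}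
    (hO : IsRightUQSGd.{w} 𝒜 O rhoO) (hP : IsRightUQSGd.{w} 𝒜 P rhoP) :
    ∃ F : O ≃ₐc[k] P, (F : O →ₗ[k] P).lTensor A ∘ₗ rhoO = rhoP := by
  obtain ⟨f, hf, -⟩ := hO.universal P rhoP hP.coacts
  obtain ⟨g, hg, -⟩ := hP.universal O rhoO hO.coacts
  obtain ⟨F, hF⟩ := UQSGd.exists_bialgEquiv
    ((hO.universal O rhoO hO.coacts).unique (lTensor_bialgHom_comp hf hg) (lTensor_bialgHom_id _))
    ((hP.universal P rhoP hP.coacts).unique (lTensor_bialgHom_comp hg hf) (lTensor_bialgHom_id _))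
  exact ⟨F, by rw [hF, hf]⟩

theorem IsTransUQSGd.exists_bialgEquiv {ι : ℕ → Type*} [∀ i, Fintype (ι i)]
    {v : ∀ i, Module.Basis (ι i) k (𝒜 i)} {lamO : A →ₗ[k] O ⊗[k] A} {lamP : A →ₗ[k] P ⊗[k] A}
    {rhoO : A →ₗ[k] A ⊗[k] O} {rhoP : A →ₗ[k] A ⊗[k] P}
    (hO : IsTransUQSGd.{w} v O lamO rhoO) (hP : IsTransUQSGd.{w} v P lamP rhoP) :
    ∃ F : O ≃ₐc[k] P, (F : O →ₗ[k] P).rTensor A ∘ₗ lamO = lamP ∧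
      (F : O →ₗ[k] P).lTensor A ∘ₗ rhoO = rhoP := by
  obtain ⟨f, hf, -⟩ := hO.universal P lamP rhoP hP.coacts_left hP.coacts_right hP.transposed
  obtain ⟨g, hg, -⟩ := hP.universal O lamO rhoO hO.coacts_left hO.coacts_right hO.transposed
  obtain ⟨F, hF⟩ := UQSGd.exists_bialgEquiv
    ((hO.universal O lamO rhoO hO.coacts_left hO.coacts_right hO.transposed).unique
      ⟨rTensor_bialgHom_comp hf.1 hg.1, lTensor_bialgHom_comp hf.2 hg.2⟩
      ⟨rTensor_bialgHom_id _, lTensor_bialgHom_id _⟩)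
    ((hP.universal P lamP rhoP hP.coacts_left hP.coacts_right hP.transposed).unique
      ⟨rTensor_bialgHom_comp hg.1 hf.1, lTensor_bialgHom_comp hg.2 hf.2⟩
      ⟨rTensor_bialgHom_id _, lTensor_bialgHom_id _⟩)
  exact ⟨F, by rw [hF, hf.1], by rw [hF, hf.2]⟩

end Unique

end UQSGd

universe w u v e

/-- Universal quantum linear semigroupoids of the path algebra of a finite quiver. -/
theorem theorem1p1 (k : Type u) [Field k] (V : Type v) [Quiver.{e} V] [Finite V]
    [∀ i j : V, Finite (i ⟶ j)] :
    (IsLeftUQSGd.{w} (pathGrading k V) (FaceAlgebra k V) (FaceAlgebra.leftCoaction k V) ∧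
      IsRightUQSGd.{w} (pathGrading k V) (FaceAlgebra k V) (FaceAlgebra.rightCoaction k V) ∧
      IsTransUQSGd.{w} (pathBasis k V) (FaceAlgebra k V) (FaceAlgebra.leftCoaction k V)
        (FaceAlgebra.rightCoaction k V)) ∧
    (∀ (O : Type (max u v e)) [Ring O] [WeakBialgebra k O]
      (lam : PathAlgebra k V →ₗ[k] TensorProduct k O (PathAlgebra k V)),
      IsLeftUQSGd.{max u v e} (pathGrading k V) O lam →
        ∃ f : O ≃ₐc[k] FaceAlgebra k V,
          (f : O →ₗ[k] FaceAlgebra k V).rTensor (PathAlgebra k V) ∘ₗ lam =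
            FaceAlgebra.leftCoaction k V) ∧
    (∀ (O : Type (max u v e)) [Ring O] [WeakBialgebra k O]
      (rho : PathAlgebra k V →ₗ[k] TensorProduct k (PathAlgebra k V) O),
      IsRightUQSGd.{max u v e} (pathGrading k V) O rho →
        ∃ f : O ≃ₐc[k] FaceAlgebra k V,
          (f : O →ₗ[k] FaceAlgebra k V).lTensor (PathAlgebra k V) ∘ₗ rho =
            FaceAlgebra.rightCoaction k V) ∧
    (∀ (O : Type (max u v e)) [Ring O] [WeakBialgebra k O]
      (lam : PathAlgebra k V →ₗ[k] TensorProduct k O (PathAlgebra k V))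
      (rho : PathAlgebra k V →ₗ[k] TensorProduct k (PathAlgebra k V) O),
      IsTransUQSGd.{max u v e} (pathBasis k V) O lam rho →
        ∃ f : O ≃ₐc[k] FaceAlgebra k V,
          (f : O →ₗ[k] FaceAlgebra k V).rTensor (PathAlgebra k V) ∘ₗ lam =
            FaceAlgebra.leftCoaction k V ∧
          (f : O →ₗ[k] FaceAlgebra k V).lTensor (PathAlgebra k V) ∘ₗ rho =
            FaceAlgebra.rightCoaction k V) := by
  exact ⟨⟨FaceAlgebra.isLeftUQSGd k V, FaceAlgebra.isRightUQSGd k V, FaceAlgebra.isTransUQSGd k V⟩,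
    fun _ _ _ _ h => h.exists_bialgEquiv (FaceAlgebra.isLeftUQSGd k V),
    fun _ _ _ _ h => h.exists_bialgEquiv (FaceAlgebra.isRightUQSGd k V),
    fun _ _ _ _ _ h => h.exists_bialgEquiv (FaceAlgebra.isTransUQSGd k V)⟩
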